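/- Let $T$ be a locally finite tree with root at infinity, i.e. a connected graph without cycles, all of whose vertices have finitely many neighbours, with a distinguished boundary point $\omega_*$ (an equivalence class of semi-infinite geodesics), and let $d$ be its graph distance. For a vertex $x$, the predecessor $\mathfrak p(x)$ is the neighbour of $x$ on the semi-infinite geodesic from $x$ to $\omega_*$, and $\mathrm{succ}(x)=\{y:\mathfrak p(y)=x\}$ is the set of successors of $x$. A level function $\ell:T\to\mathbb Z$, $\ell(x)=\lim_{j\to\infty}[\,j-d(x,x_j)]$, is fixed, where $(x_j)_{j\ge0}$ is a semi-infinite geodesic with endpoint $\omega_*$. A flow measure is a function $m:T\to(0,\infty)$ with $m(x)=\sum_{y\in\mathrm{succ}(x)}m(y)$ for all $x$; it is identified with the discrete measure with density $m$, and $(T,m)$ is called a flow tree. Let $\Sigma f(x)=f(\mathfrak p(x))$, $\nabla=I-\Sigma$, and let $\mathcal L=\tfrac12\nabla^*\nabla$ be the flow Laplacian, a bounded self-adjoint operator on $L^2(m)$, where $\nabla^*$ is the adjoint of $\nabla$ on $L^2(m)$. For continuous $F:\mathbb R\to\mathbb C$, $F(\mathcal L)$ is defined by the spectral theorem on $L^2(m)$,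 and $K_{F(\mathcal L)}:T\times T\to\mathbb C$ denotes its integral kernel, $F(\mathcal L)f(x)=\sum_{y}K_{F(\mathcal L)}(x,y)f(y)m(y)$. For $p\in[1,\infty]$, $\|F(\mathcal L)\|_{L^p(m)\to L^p(m)}\in[0,\infty]$ is the operator norm on $L^p(m)$ of the integral operator with this kernel ($\infty$ if it is not bounded on $L^p(m)$). For a positive integer $q$, let $\mathbb T_q$ be the homogeneous tree of degree $q+1$ with root at infinity (so each vertex has exactly $q$ successors), with its canonical flow measure $m_{\mathbb T_q}(x)=q^{\ell(x)}$, distance $d_{\mathbb T_q}$ and flow Laplacian $\mathcal L_{\mathbb T_q}$. **Theorem.** Let $(T,m)$ be a flow tree, let $\varepsilon>0$, and let $F:\mathbb R\to\mathbb C$ belong to the inhomogeneous Sobolev space $L^2_{3/2+\varepsilon}(\mathbb R)$, where $F$ is identified with its continuous representative. Then, for all $p\in[1,\infty]$, $$\|F(\mathcal L)\|_{L^p(m)\to L^p(m)}\le\liminf_{q\to\infty}\|F(\mathcal L_{\mathbb T_q})\|_{L^p(m_{\mathbb T_q})\to L^p(m_{\mathbb T_q})}.$$ Moreover, for every weight $w:\mathbb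 N\times\mathbb Z\times\mathbb Z\to[0,\infty)$ which is (weakly) increasing in the first variable, $$\sup_{y\in T}\sum_{x\in T}w(d(x,y),\ell(x),\ell(y))\,|K_{F(\mathcal L)}(x,y)|\,m(x)\le\liminf_{q\to\infty}\ \sup_{y\in\mathbb T_q}\sum_{x\in\mathbb T_q}w(d_{\mathbb T_q}(x,y),\ell(x),\ell(y))\,|K_{F(\mathcal L_{\mathbb T_q})}(x,y)|\,m_{\mathbb T_q}(x).$$ -/

import Mathlib

open MeasureTheory Filter Topology
open scoped ENNReal NNReal

/-! ### Trees with root at infinity -/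

/-- A semi-infinite geodesic `x₀, x₁, x₂, …` in a graph. -/
structure GeodesicRay {V : Type*} (G : SimpleGraph V) where
  vertex : ℕ → V
  geodesic : ∀ i j : ℕ, i ≤ j → G.dist (vertex i) (vertex j) = j - i

/-- Two semi-infinite geodesics are equivalent (they have the same endpoint) if they eventually
coincide, up to a shift of the parametrization. -/
def GeodesicRay.setoid {V : Type*} (G : SimpleGraph V) : Setoid (GeodesicRay G) where
  r a b := ∃ k n : ℕ, ∀ i : ℕ, a.vertex (i + k) = b.vertex (i + n)
  iseqv :=
    { refl := fun _ => ⟨0, 0, fun _ => rfl⟩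
      symm := fun ⟨k, n, h⟩ => ⟨n, k, fun i => (h i).symm⟩
      trans := by
        rintro a b c ⟨k, n, h⟩ ⟨k', n', h'⟩
        refine ⟨k + k', n' + n, fun i => ?_⟩
        have h1 := h (i + k')
        have h2 := h' (i + n)
        rw [show i + (k + k') = i + k' + k by ring, h1,
          show i + k' + n = i + n + k' by ring, h2]
        congr 1
        ring }

/-- The boundary at infinity `∂T`: equivalence classes of semi-infinite geodesics. -/
def TreeBoundary {V : Type*} (G : SimpleGraph V) : Type _ := Quotient (GeodesicRay.setoid G)

/-- The endpoint at infinity of a semi-infinite geodesic. -/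
def GeodesicRay.endpoint {V : Type*} {G : SimpleGraph V} (r : GeodesicRay G) : TreeBoundary G :=
  Quotient.mk (GeodesicRay.setoid G) r

/-- A locally finite (necessarily infinite) tree with root at infinity, i.e. with a distinguished
boundary point, together with the choice of a level function. -/
structure InftyRootedTree.{u} where
  V : Type u
  graph : SimpleGraph V
  isTree : graph.IsTree
  locallyFinite : ∀ x : V, (graph.neighborSet x).Finite
  /-- the root at infinity -/
  root : TreeBoundary graph
  /-- the level function -/
  level : V → ℤ
  level_spec : ∃ r : GeodesicRay graph, r.endpoint = root ∧
    ∀ x : V, Tendsto (fun j : ℕ => (j : ℤ) - (graph.dist x (r.vertex j) : ℤ)) atTop (𝓝 (level x))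

namespace InftyRootedTree

/-- `T.le x y`: the vertex `y` belongs to the semi-infinite geodesic from `x` to the root
at infinity, i.e. `y` is above `x`. -/
def le (T : InftyRootedTree) (x y : T.V) : Prop :=
  ∃ r : GeodesicRay T.graph, r.endpoint = T.root ∧ r.vertex 0 = x ∧ ∃ n : ℕ, r.vertex n = y

theorem exists_pred (T : InftyRootedTree) (x : T.V) : ∃ y : T.V, T.graph.Adj x y ∧ T.le x y := by
  obtain ⟨r, hr, hlev⟩ := T.level_spec
  have hconn : T.graph.Connected := T.isTree.1
  have hx := hlev x
  rw [nhds_discrete, tendsto_pure, eventually_atTop] at hx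
  obtain ⟨k₀, hk₀⟩ := hx
  -- from the time `k` on, the ray `r` moves away from `x` at unit speed
  obtain ⟨k, hk, hpos⟩ : ∃ k, k₀ ≤ k ∧ 0 < (k : ℤ) - T.level x := by
    refine ⟨max k₀ ((T.level x).toNat + 1), le_max_left _ _, ?_⟩
    have h1 : (T.level x).toNat + 1 ≤ max k₀ ((T.level x).toNat + 1) := le_max_right _ _
    have h2 := Int.self_le_toNat (T.level x)
    omega
  obtain ⟨p, hp⟩ := hconn.exists_walk_length_eq_dist x (r.vertex k)
  set d := T.graph.dist x (r.vertex k) with hd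
  have hdist : ∀ j, T.graph.dist x (r.vertex (k + j)) = d + j := by
    intro j
    have h1 := hk₀ (k + j) (by omega)
    have h2 := hk₀ k hk
    push_cast at h1
    omega
  let s : ℕ → T.V := fun i => if i ≤ d then p.getVert i else r.vertex (k + (i - d))
  have hs1 : ∀ i, d ≤ i → s i = r.vertex (k + (i - d)) := by
    intro i hi
    by_cases h : i ≤ d
    · have : i = d := le_antisymm h hi
      subst this
      simp only [s, le_refl, if_true]
      rw [← hp, p.getVert_length]
      simp
    · simp only [s, if_neg h]
  have hstep : ∀ i, T.graph.dist (s i) (s (i + 1)) ≤ 1 := by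
    intro i
    by_cases h : i + 1 ≤ d
    · have h' : i ≤ d := by omega
      simp only [s, if_pos h, if_pos h']
      have hadj := p.adj_getVert_succ (i := i) (by omega)
      exact (SimpleGraph.dist_eq_one_iff_adj.mpr hadj).le
    · rw [hs1 i (by omega), hs1 (i + 1) (by omega), r.geodesic _ _ (by omega)]
      omega
  have hs0 : s 0 = x := by simp [s]
  have hle : ∀ i j, T.graph.dist (s i) (s (i + j)) ≤ j := by
    intro i j
    induction j with
    | zero => simp
    | succ j ih =>
      have := hconn.dist_triangle (u := s i) (v := s (i + j)) (w := s (i + (j + 1)))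
      have h2 := hstep (i + j)
      rw [show i + (j + 1) = i + j + 1 by ring] at this ⊢
      omega
  have hxs : ∀ j, T.graph.dist x (s j) = j := by
    intro j
    have h1 : T.graph.dist x (s (j + d)) = j + d := by
      rw [hs1 (j + d) (by omega), hdist]
      omega
    have h2 := hconn.dist_triangle (u := x) (v := s j) (w := s (j + d))
    have h3 := hle j d
    have h4 := hle 0 j
    rw [hs0, zero_add] at h4
    omega
  let s' : GeodesicRay T.graph :=
    ⟨s, fun i j hij => by
      have h1 := hle i (j - i)
      rw [show i + (j - i) = j by omega] at h1
      have h2 := hconn.dist_triangle (u := x) (v := s i) (w := s j)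
      rw [hxs, hxs] at h2
      omega⟩
  refine ⟨s 1, ?_, s', ?_, hs0, 1, rfl⟩
  · have := hxs 1
    exact SimpleGraph.dist_eq_one_iff_adj.mp this
  · rw [← hr]
    refine Quotient.sound ⟨d, k, fun i => ?_⟩
    change s (i + d) = _
    rw [hs1 _ (by omega)]
    congr 1
    omega

/-- The predecessor of `x`: the neighbour of `x` lying above `x`. -/
noncomputable def pred (T : InftyRootedTree) (x : T.V) : T.V := (T.exists_pred x).choose

theorem adj_pred (T : InftyRootedTree) (x : T.V) : T.graph.Adj x (T.pred x) :=
  (T.exists_pred x).choose_spec.1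

/-- The set of successors of `x`. -/
def succ (T : InftyRootedTree) (x : T.V) : Set T.V := {y | T.pred y = x}

theorem finite_succ (T : InftyRootedTree) (x : T.V) : (T.succ x).Finite :=
  (T.locallyFinite x).subset fun y hy => by
    have h := T.adj_pred y
    rw [show T.pred y = x from hy] at h
    exact h.symm

end InftyRootedTree

/-! ### Flow trees and the flow Laplacian -/

/-- A flow tree `(T, m)`: a tree with root at infinity equipped with a flow measure. -/
structure FlowTree.{u} extends InftyRootedTree.{u} where
  m : V → ℝ
  m_pos : ∀ x : V, 0 < m x
  m_flow : ∀ x : V, m x = ∑ᶠ y ∈ toInftyRootedTree.succ x, m y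

namespace FlowTree

/-- `T` is the homogeneous tree of degree `q + 1` with its canonical flow measure `q ^ ℓ(x)`. -/
def IsCanonicalHomogeneous (T : FlowTree) (q : ℕ+) : Prop :=
  (∀ x : T.V, (T.succ x).ncard = q) ∧ ∀ x : T.V, T.m x = (q : ℝ) ^ T.level x

instance instMeasurableSpaceV (T : FlowTree) : MeasurableSpace T.V := ⊤

instance instDiscreteMeasurableSpaceV (T : FlowTree) : DiscreteMeasurableSpace T.V :=
  ⟨fun _ => trivial⟩

/-- The discrete measure on the vertices with density `m` with respect to the counting measure. -/
noncomputable def measure (T : FlowTree) : Measure T.V :=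
  Measure.count.withDensity fun x => ENNReal.ofReal (T.m x)

theorem measure_apply (T : FlowTree) (s : Set T.V) :
    T.measure s = ∑' x, s.indicator (fun x => ENNReal.ofReal (T.m x)) x := by
  rw [measure, withDensity_apply _ (MeasurableSet.of_discrete),
    ← lintegral_indicator MeasurableSet.of_discrete, lintegral_count]

theorem measure_singleton (T : FlowTree) (x : T.V) :
    T.measure {x} = ENNReal.ofReal (T.m x) := by
  rw [measure_apply, tsum_eq_single x]
  · simp
  · intro y hy
    simp [hy]

theorem measure_singleton_ne_top (T : FlowTree) (x : T.V) : T.measure {x} ≠ ∞ := by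
  rw [measure_singleton]
  exact ENNReal.ofReal_ne_top

theorem measurePreserving_pred (T : FlowTree) :
    MeasurePreserving T.pred T.measure T.measure := by
  refine ⟨Measurable.of_discrete, ?_⟩
  ext s -
  rw [Measure.map_apply Measurable.of_discrete MeasurableSet.of_discrete,
    measure_apply, measure_apply, ← (Equiv.sigmaFiberEquiv T.pred).tsum_eq, ENNReal.tsum_sigma']
  refine tsum_congr fun y => ?_
  have hm : ENNReal.ofReal (T.m y)
      = ∑' x : {x // T.pred x = y}, ENNReal.ofReal (T.m x) := by
    have hfin : Finite {x // T.pred x = y} := T.finite_succ y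
    have hft : Fintype {x // T.pred x = y} := Fintype.ofFinite _
    have hsum : T.m y = ∑ x : {x // T.pred x = y}, T.m x.1 := by
      rw [T.m_flow y, ← finsum_eq_sum_of_fintype]
      exact (finsum_subtype_eq_finsum_cond (f := T.m) fun x => T.pred x = y).symm
    rw [tsum_fintype, hsum]
    exact ENNReal.ofReal_sum_of_nonneg fun x _ => (T.m_pos x.1).le
  by_cases hy : y ∈ s
  · rw [Set.indicator_of_mem hy, hm]
    refine tsum_congr fun x => ?_
    have : T.pred x.1 ∈ s := by rw [x.2]; exact hy
    exact Set.indicator_of_mem (s := T.pred ⁻¹' s) this _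
  · rw [Set.indicator_of_notMem hy, ENNReal.tsum_eq_zero]
    intro x
    have : T.pred x.1 ∉ s := by rw [x.2]; exact hy
    exact Set.indicator_of_notMem (s := T.pred ⁻¹' s) this _

/-- The Hilbert space `L²(m)`. -/
abbrev L2 (T : FlowTree) : Type _ := Lp ℂ 2 T.measure

/-- The shift operator `Σ f (x) = f (𝔭 (x))` on `L²(m)`. -/
noncomputable def shift (T : FlowTree) : T.L2 →L[ℂ] T.L2 :=
  (Lp.compMeasurePreservingₗᵢ ℂ T.pred T.measurePreserving_pred).toContinuousLinearMap

/-- The flow gradient `∇ = I - Σ` on `L²(m)`. -/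
noncomputable def gradient (T : FlowTree) : T.L2 →L[ℂ] T.L2 :=
  ContinuousLinearMap.id ℂ T.L2 - T.shift

/-- The flow Laplacian `𝓛 = ½ ∇* ∇` on `L²(m)`, a bounded nonnegative self-adjoint operator. -/
noncomputable def laplacian (T : FlowTree) : T.L2 →L[ℂ] T.L2 :=
  (1 / 2 : ℂ) • (ContinuousLinearMap.adjoint T.gradient ∘L T.gradient)

/-- The operator `F(𝓛)` on `L²(m)` defined by the continuous functional calculus of the
self-adjoint operator `𝓛`; as the spectrum of `𝓛` is real, the function `F` on the real line is
regarded as the function `z ↦ F (re z)`. -/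
noncomputable def functionOfLaplacian (T : FlowTree) (F : ℝ → ℂ) : T.L2 →L[ℂ] T.L2 :=
  cfc (fun z : ℂ => F z.re) T.laplacian

/-- The integral kernel of an operator `A` on `L²(m)`, i.e. the function `K` on pairs of vertices
such that `A f (x) = ∑_y K (x, y) f (y) m (y)`; testing on the characteristic function of `{y}`,
`K (x, y) = (A 1_{y}) (x) / m (y)`. -/
noncomputable def kernel (T : FlowTree) (A : T.L2 →L[ℂ] T.L2) (x y : T.V) : ℂ :=
  A (indicatorConstLp 2 (MeasurableSet.of_discrete (s := {y})) (T.measure_singleton_ne_top y)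
    (1 : ℂ)) x / T.m y

/-- `LpBound K p C`: the integral operator `f ↦ ∑_y K (·, y) f (y) m (y)`, with kernel `K`, is
well defined on all of `L^p(m)` and bounded from `L^p(m)` to `L^p(m)` with norm at most `C`. -/
def LpBound (T : FlowTree) (K : T.V → T.V → ℂ) (p C : ℝ≥0∞) : Prop :=
  ∀ f : T.V → ℂ, MemLp f p T.measure →
    (∀ x, Summable fun y => K x y * f y * (T.m y : ℂ)) ∧
    eLpNorm (fun x => ∑' y, K x y * f y * (T.m y : ℂ)) p T.measure ≤ C * eLpNorm f p T.measure

/-- The norm `‖A‖_{L^p(m) → L^p(m)} ∈ [0, ∞]` of the operator with integral kernel `K_A`; its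
value is `∞` when the operator is not bounded on `L^p(m)`. -/
noncomputable def LpOpNorm (T : FlowTree) (A : T.L2 →L[ℂ] T.L2) (p : ℝ≥0∞) : ℝ≥0∞ :=
  sInf {C : ℝ≥0∞ | T.LpBound (T.kernel A) p C}

/-- The weighted kernel norm
`sup_y ∑_x w(d(x, y), ℓ(x), ℓ(y)) |K_A(x, y)| m(x) ∈ [0, ∞]`. -/
noncomputable def weightedKernelNorm (T : FlowTree) (w : ℕ → ℤ → ℤ → ℝ≥0)
    (A : T.L2 →L[ℂ] T.L2) : ℝ≥0∞ :=
  ⨆ y : T.V, ∑' x : T.V, (w (T.graph.dist x y) (T.level x) (T.level y) : ℝ≥0∞) *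
    ‖T.kernel A x y‖ₑ * ENNReal.ofReal (T.m x)

end FlowTree

/-! ### Sobolev spaces on the real line -/

/-- `F` belongs to the inhomogeneous Sobolev space `L²_s(ℝ)`, for `s ≥ 0`: `F` is in `L²(ℝ)` and,
as a tempered distribution, it lies in the Bessel potential space of order `s`. -/
def MemL2Sobolev (s : ℝ) (F : ℝ → ℂ) : Prop :=
  ∃ hF : MemLp F 2 (volume : Measure ℝ),
    TemperedDistribution.MemSobolev s 2 (Lp.toTemperedDistribution (hF.toLp F))

/-! Since `T.shift` (written Σ) preserves the `L²` norm, Σ*Σ = 1, and 𝓛 = 1 − (Σ + Σ*)/2. The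
relation Σ*Σ = 1 alone shows that the sum of the words Σ^a Σ*^b with a + b = n satisfies the
recursion of the Chebyshev polynomials of the second kind, so it equals U_n(1 − 𝓛) on every flow
tree (`functionOfLaplacian_chebyshevU`). The word Σ^a Σ*^b has kernel 1/m(𝔭^a x) where 𝔭^a x = 𝔭^b
y, and 0 elsewhere. If z is the confluent of x and y and d their distance, this gives K(x, y) = ∑_k
c_{d+2k} / m(𝔭^k z), where the c_n are the U-coefficients of F and do not depend on the tree. The
sums of c_{d+2k} telescope and 1/m decreases going up, so Abel's inequality gives a bound uniform in
the number of terms; by density of polynomials the expansion holds for every continuous F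
(`tendsto_kernelSum`).

On 𝕋_q the mass is multiplied by q at each step up, so the first term dominates as q → ∞. For the
weighted norm, the triangle inequality on T gives a sum over words that depends only on the c_n and
the level of y (`tsum_weight_mul_kernel_le`). On 𝕋_q the same sum is a lower bound up to errors
O(1/q) in each term (`le_tsum_weight_mul_kernel`).

For the `L^p` norm, T is simulated inside 𝕋_q. Below a vertex labelled x, about the proportion
m(y)/m(x) of the q successors receives the label y, for each successor y of x. A finitely supported
f on T is pulled back to functions constant on label classes. On these, the part of F(𝓛_{𝕋_q}) below
the root of the labelling acts by weights depending only on labels, which converge to the truncated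
expansion on T (`sum_truncKernel_fiber`, `tendsto_modelWeight`). The rest is O(1/q), and the norms
of f and of its pullback agree asymptotically up to a common factor. Bounds valid for arbitrarily
large q therefore pass to T. -/

namespace SimpleGraph

/-- In a tree, the neighbour of `u` that is closer to `z` is unique. -/
theorem IsTree.eq_of_adj_of_dist {V : Type*} {G : SimpleGraph V} (hG : G.IsTree) {u v w z : V}
    (hv : G.Adj u v) (hw : G.Adj u w) (hvz : G.dist u z = G.dist v z + 1)
    (hwz : G.dist u z = G.dist w z + 1) : v = w := by
  obtain ⟨p, hp⟩ := hG.connected.exists_walk_length_eq_dist v z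
  obtain ⟨q, hq⟩ := hG.connected.exists_walk_length_eq_dist w z
  have h1 : (Walk.cons hv p).IsPath := Walk.isPath_of_length_eq_dist _ (by simp [hp, hvz])
  have h2 : (Walk.cons hw q).IsPath := Walk.isPath_of_length_eq_dist _ (by simp [hq, hwz])
  have h3 := (hG.isAcyclic.subsingleton_path u z).elim ⟨_, h1⟩ ⟨_, h2⟩
  have h4 := congrArg (fun p : G.Path u z => p.1.snd) h3
  simpa using h4

end SimpleGraph

/-! ### Levels, common ancestors and confluents. -/

namespace InftyRootedTree

variable (T : InftyRootedTree)

theorem exists_ray_level : ∃ r : GeodesicRay T.graph, r.endpoint = T.root ∧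
    ∀ x : T.V, ∀ᶠ j : ℕ in atTop, T.level x = (j : ℤ) - (T.graph.dist x (r.vertex j) : ℤ) := by
  obtain ⟨r, hr, hlev⟩ := T.level_spec
  refine ⟨r, hr, fun x => ?_⟩
  have hx := hlev x
  rw [nhds_discrete, tendsto_pure] at hx
  exact hx.mono fun _ h => h.symm

/-- The ray through x and its predecessor eventually merges with the ray that computes levels, so
both levels are read off along a single geodesic. -/
theorem level_pred (x : T.V) : T.level (T.pred x) = T.level x + 1 := by
  obtain ⟨r₀, hr₀, hlev⟩ := T.exists_ray_level
  obtain ⟨r, hr, hrx, n, hn⟩ := (T.exists_pred x).choose_spec.2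
  have hadj := T.adj_pred x
  change r.vertex n = T.pred x at hn
  have hn1 : n = 1 := by
    have h1 := r.geodesic 0 n (Nat.zero_le n)
    rw [hrx, hn, SimpleGraph.dist_eq_one_iff_adj.mpr hadj] at h1
    simpa using h1.symm
  subst hn1
  obtain ⟨k, l, hkl⟩ := Quotient.exact (hr.trans hr₀.symm)
  obtain ⟨j₀, hj₀⟩ := eventually_atTop.mp ((hlev x).and (hlev (T.pred x)))
  obtain ⟨h1, h2⟩ := hj₀ (j₀ + 1 + l) (by omega)
  rw [← hkl, ← hrx, r.geodesic _ _ (by omega)] at h1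
  rw [← hkl, ← hn, r.geodesic _ _ (by omega)] at h2
  rw [hrx] at h1
  rw [hn] at h2
  omega

theorem level_pred_iterate (n : ℕ) (x : T.V) : T.level (T.pred^[n] x) = T.level x + n := by
  induction n with
  | zero => simp
  | succ n ih =>
    rw [Function.iterate_succ_apply', level_pred, ih]
    push_cast
    ring

/-- Every edge joins a vertex to its predecessor. -/
theorem eq_pred_or_eq_pred_of_adj {u v : T.V} (h : T.graph.Adj u v) :
    v = T.pred u ∨ u = T.pred v := by
  obtain ⟨r, -, hlev⟩ := T.exists_ray_level
  -- Seen from a far point of the ray, one end of the edge is nearer by one; the predecessor of the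
  -- other end is nearer too, and the nearer neighbour is unique.
  obtain ⟨j₀, hj₀⟩ := eventually_atTop.mp
    ((((hlev u).and (hlev v)).and (hlev (T.pred u))).and (hlev (T.pred v)))
  obtain ⟨⟨⟨h1, h2⟩, h3⟩, h4⟩ := hj₀ j₀ le_rfl
  rw [level_pred] at h3 h4
  have h5 := T.isTree.dist_eq_dist_add_one_of_adj (r.vertex j₀) h
  simp only [SimpleGraph.dist_comm (u := r.vertex j₀)] at h5
  rcases h5 with h5 | h5
  · exact Or.inl (T.isTree.eq_of_adj_of_dist h (T.adj_pred u) h5 (by omega))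
  · exact Or.inr (T.isTree.eq_of_adj_of_dist h.symm (T.adj_pred v) h5 (by omega))

/-- Induction on the walk: an initial step up increases a, while an initial step down cancels a
later step up or, if a = 0, increases b. -/
theorem exists_common_ancestor_of_walk {x y : T.V} (p : T.graph.Walk x y) :
    ∃ a b : ℕ, T.pred^[a] x = T.pred^[b] y ∧ a + b ≤ p.length := by
  induction p with
  | nil => exact ⟨0, 0, rfl, le_rfl⟩
  | @cons u v w huv p ih =>
    obtain ⟨a, b, hab, hle⟩ := ih
    rw [SimpleGraph.Walk.length_cons]
    rcases T.eq_pred_or_eq_pred_of_adj huv with h | h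
    · refine ⟨a + 1, b, ?_, by omega⟩
      rw [Function.iterate_succ_apply, ← h, hab]
    · rcases a with _ | a
      · refine ⟨0, b + 1, ?_, by omega⟩
        rw [Function.iterate_succ_apply', ← hab, h]
        rfl
      · refine ⟨a, b, ?_, by omega⟩
        rw [h, ← hab, Function.iterate_succ_apply]

theorem exists_common_ancestor (x y : T.V) :
    ∃ a b : ℕ, T.pred^[a] x = T.pred^[b] y ∧ a + b ≤ T.graph.dist x y := by
  obtain ⟨p, hp⟩ := T.isTree.connected.exists_walk_length_eq_dist x y
  rw [← hp]
  exact T.exists_common_ancestor_of_walk p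

theorem dist_pred_iterate_le (n : ℕ) (x : T.V) : T.graph.dist x (T.pred^[n] x) ≤ n := by
  induction n with
  | zero => simp
  | succ n ih =>
    have h1 := T.isTree.connected.dist_triangle (u := x) (v := T.pred^[n] x)
      (w := T.pred^[n + 1] x)
    have h2 : T.graph.dist (T.pred^[n] x) (T.pred^[n + 1] x) = 1 := by
      rw [Function.iterate_succ_apply']
      exact SimpleGraph.dist_eq_one_iff_adj.mpr (T.adj_pred _)
    omega

theorem dist_le_of_pred_iterate_eq {x y : T.V} {a b : ℕ} (h : T.pred^[a] x = T.pred^[b] y) :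
    T.graph.dist x y ≤ a + b := by
  have h1 := T.isTree.connected.dist_triangle (u := x) (v := T.pred^[a] x) (w := y)
  have h2 := T.dist_pred_iterate_le a x
  have h3 := T.dist_pred_iterate_le b y
  rw [SimpleGraph.dist_comm, ← h] at h3
  omega

theorem level_eq_of_pred_iterate_eq {x y : T.V} {a b : ℕ} (h : T.pred^[a] x = T.pred^[b] y) :
    T.level x + a = T.level y + b := by
  rw [← level_pred_iterate, ← level_pred_iterate, h]

/-- The pair `(a, b)` is minimal with the property that `𝔭 ^ a (x) = 𝔭 ^ b (y)`. -/
def IsConfluent (x y : T.V) (a b : ℕ) : Prop :=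
  T.pred^[a] x = T.pred^[b] y ∧
    ∀ a' b' : ℕ, T.pred^[a'] x = T.pred^[b'] y → ∃ k, a' = a + k ∧ b' = b + k

variable {T}

theorem pred_iterate_add_eq {x y : T.V} {a b : ℕ} (h : T.pred^[a] x = T.pred^[b] y) (k : ℕ) :
    T.pred^[a + k] x = T.pred^[b + k] y := by
  rw [add_comm a, add_comm b, Function.iterate_add_apply, h, ← Function.iterate_add_apply]

variable (T)

/-- Levels determine a − b, so the meeting pairs form a chain and the one with least a is below all
others. -/
theorem exists_isConfluent (x y : T.V) : ∃ a b : ℕ, T.IsConfluent x y a b := by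
  classical
  have hex : ∃ a, ∃ b, T.pred^[a] x = T.pred^[b] y := by
    obtain ⟨a, b, h, -⟩ := T.exists_common_ancestor x y
    exact ⟨a, b, h⟩
  obtain ⟨b, hb⟩ := Nat.find_spec hex
  refine ⟨Nat.find hex, b, hb, fun a' b' h => ?_⟩
  have h1 : Nat.find hex ≤ a' := Nat.find_min' hex ⟨b', h⟩
  have h2 := T.level_eq_of_pred_iterate_eq hb
  have h3 := T.level_eq_of_pred_iterate_eq h
  exact ⟨a' - Nat.find hex, by omega, by omega⟩

variable {T}

theorem IsConfluent.le_dist {x y : T.V} {a b : ℕ} (h : T.IsConfluent x y a b) :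
    a + b ≤ T.graph.dist x y := by
  obtain ⟨a', b', h', hle⟩ := T.exists_common_ancestor x y
  obtain ⟨k, rfl, rfl⟩ := h.2 a' b' h'
  omega

theorem IsConfluent.unique {x y : T.V} {a b a' b' : ℕ} (h : T.IsConfluent x y a b)
    (h' : T.IsConfluent x y a' b') : a = a' ∧ b = b' := by
  obtain ⟨k, h1, h2⟩ := h.2 _ _ h'.1
  obtain ⟨k', h3, h4⟩ := h'.2 _ _ h.1
  omega

/-- A meeting pair that is not minimal has (a − 1, b − 1) as another meeting pair, so only that one
has to be excluded. -/
theorem isConfluent_of_forall {x y : T.V} {a b : ℕ} (h : T.pred^[a] x = T.pred^[b] y)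
    (hmin : ∀ a' b', a = a' + 1 → b = b' + 1 → T.pred^[a'] x ≠ T.pred^[b'] y) :
    T.IsConfluent x y a b := by
  obtain ⟨a₀, b₀, h₀⟩ := T.exists_isConfluent x y
  obtain ⟨k, hk1, hk2⟩ := h₀.2 a b h
  rcases k with _ | k
  · rw [add_zero] at hk1 hk2
    rwa [hk1, hk2]
  · exact absurd (pred_iterate_add_eq h₀.1 k) (hmin _ _ (by omega) (by omega))

end InftyRootedTree

/-! ### The shift, its words, and the Laplacian. -/

namespace FlowTree

variable (T : FlowTree)

theorem measure_real_singleton (x : T.V) : T.measure.real {x} = T.m x := by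
  rw [Measure.real, measure_singleton, ENNReal.toReal_ofReal (T.m_pos x).le]

theorem ae_measure_iff {P : T.V → Prop} : (∀ᵐ x ∂T.measure, P x) ↔ ∀ x, P x := by
  refine ⟨fun h x => ?_, fun h => Eventually.of_forall h⟩
  by_contra hx
  have h1 : T.measure {x} ≤ 0 := by
    rw [← ae_iff.mp h]
    exact measure_mono (by simpa using hx)
  rw [measure_singleton, nonpos_iff_eq_zero, ENNReal.ofReal_eq_zero] at h1
  exact absurd (T.m_pos x) (not_lt.mpr h1)

theorem measure_preimage_pred_iterate (n : ℕ) (s : Set T.V) :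
    T.measure (T.pred^[n] ⁻¹' s) = T.measure s :=
  (T.measurePreserving_pred.iterate n).measure_preimage
    (MeasurableSet.of_discrete (s := s)).nullMeasurableSet

theorem m_le_m_pred (x : T.V) : T.m x ≤ T.m (T.pred x) := by
  have h := T.measure_preimage_pred_iterate 1 {T.pred x}
  have h1 : T.measure {x} ≤ T.measure (T.pred^[1] ⁻¹' {T.pred x}) :=
    measure_mono (by simp)
  rw [h, measure_singleton, measure_singleton,
    ENNReal.ofReal_le_ofReal_iff (T.m_pos _).le] at h1
  exact h1

theorem monotone_m_pred_iterate (x : T.V) : Monotone fun n => T.m (T.pred^[n] x) :=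
  monotone_nat_of_le_succ fun n => by
    rw [Function.iterate_succ_apply']
    exact T.m_le_m_pred _

/-- The characteristic function of the vertex `x`, as an element of `L²(m)`. -/
noncomputable def single (x : T.V) : T.L2 :=
  indicatorConstLp 2 (MeasurableSet.of_discrete (s := {x})) (T.measure_singleton_ne_top x) (1 : ℂ)

theorem inner_single_left (x : T.V) (f : T.L2) : inner ℂ (T.single x) f = T.m x * f x := by
  rw [single, L2.inner_indicatorConstLp_one, integral_singleton, measure_real_singleton]
  simp

theorem single_apply [DecidableEq T.V] (x y : T.V) :
    T.single x y = if y = x then (1 : ℂ) else 0 := by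
  have h : ∀ᵐ y ∂T.measure, T.single x y = ({x} : Set T.V).indicator (fun _ => (1 : ℂ)) y :=
    indicatorConstLp_coeFn
  rw [T.ae_measure_iff.mp h y, Set.indicator_apply]
  rfl

theorem m_ne_zero (x : T.V) : (T.m x : ℂ) ≠ 0 := by
  exact_mod_cast (T.m_pos x).ne'

theorem kernel_eq_inner (A : T.L2 →L[ℂ] T.L2) (x y : T.V) :
    T.kernel A x y = inner ℂ (T.single x) (A (T.single y)) / (T.m x * T.m y) := by
  rw [inner_single_left, mul_div_mul_left _ _ (T.m_ne_zero x)]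
  rfl

theorem kernel_add (A B : T.L2 →L[ℂ] T.L2) (x y : T.V) :
    T.kernel (A + B) x y = T.kernel A x y + T.kernel B x y := by
  simp only [kernel_eq_inner, add_div, _root_.add_apply, inner_add_right]

theorem kernel_smul (c : ℂ) (A : T.L2 →L[ℂ] T.L2) (x y : T.V) :
    T.kernel (c • A) x y = c * T.kernel A x y := by
  simp only [kernel_eq_inner, _root_.smul_apply, inner_smul_right, mul_div_assoc]

theorem kernel_sum {ι : Type*} (s : Finset ι) (A : ι → T.L2 →L[ℂ] T.L2) (x y : T.V) :
    T.kernel (∑ i ∈ s, A i) x y = ∑ i ∈ s, T.kernel (A i) x y := by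
  simp only [kernel_eq_inner, _root_.sum_apply, inner_sum, Finset.sum_div]

theorem norm_kernel_sub_le (A B : T.L2 →L[ℂ] T.L2) (x y : T.V) :
    ‖T.kernel A x y - T.kernel B x y‖
      ≤ ‖A - B‖ * (‖T.single x‖ * ‖T.single y‖ / (T.m x * T.m y)) := by
  have h : T.kernel A x y - T.kernel B x y
      = inner ℂ (T.single x) ((A - B) (T.single y)) / (T.m x * T.m y) := by
    simp only [kernel_eq_inner, _root_.sub_apply, inner_sub_right, sub_div]
  have hpos := mul_pos (T.m_pos x) (T.m_pos y)
  rw [h, norm_div, norm_mul, Complex.norm_real, Complex.norm_real, Real.norm_of_nonneg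
    (T.m_pos x).le, Real.norm_of_nonneg (T.m_pos y).le, ← mul_div_assoc]
  gcongr
  refine (norm_inner_le_norm _ _).trans ?_
  have := (A - B).le_opNorm (T.single y)
  calc _ ≤ ‖T.single x‖ * (‖A - B‖ * ‖T.single y‖) := by gcongr
    _ = _ := by ring

theorem shift_apply (f : T.L2) (x : T.V) : T.shift f x = f (T.pred x) :=
  T.ae_measure_iff.mp (Lp.coeFn_compMeasurePreserving f T.measurePreserving_pred) x

theorem norm_shift (f : T.L2) : ‖T.shift f‖ = ‖f‖ :=
  (Lp.compMeasurePreservingₗᵢ ℂ T.pred T.measurePreserving_pred).norm_map f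

theorem adjoint_shift_comp_shift :
    ContinuousLinearMap.adjoint T.shift * T.shift = 1 :=
  T.shift.norm_map_iff_adjoint_comp_self.mp T.norm_shift

theorem norm_shift_le : ‖T.shift‖ ≤ 1 :=
  T.shift.opNorm_le_bound zero_le_one fun f => by rw [norm_shift, one_mul]

theorem adjoint_shift_single (x : T.V) :
    ContinuousLinearMap.adjoint T.shift (T.single x)
      = (T.m x / T.m (T.pred x) : ℂ) • T.single (T.pred x) := by
  refine ext_inner_right ℂ fun g => ?_
  rw [ContinuousLinearMap.adjoint_inner_left, inner_single_left, inner_smul_left,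
    inner_single_left, shift_apply, map_div₀, Complex.conj_ofReal, Complex.conj_ofReal, ← mul_assoc,
    div_mul_cancel₀ _ (T.m_ne_zero _)]

theorem adjoint_shift_pow_single (n : ℕ) (x : T.V) :
    (ContinuousLinearMap.adjoint T.shift ^ n) (T.single x)
      = (T.m x / T.m (T.pred^[n] x) : ℂ) • T.single (T.pred^[n] x) := by
  induction n with
  | zero => simp [div_self (T.m_ne_zero x)]
  | succ n ih =>
    rw [pow_succ', mul_apply_eq_comp, ih, map_smul, adjoint_shift_single, smul_smul,
      Function.iterate_succ_apply', div_mul_div_cancel₀ (T.m_ne_zero _)]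

/-- Moving Σ^a across the inner product makes both indicators climb; the pairing sees only whether
they land on the same vertex, and the factors m(x), m(y) cancel. -/
theorem kernel_shift_pow_mul [DecidableEq T.V] (a b : ℕ) (x y : T.V) :
    T.kernel (T.shift ^ a * ContinuousLinearMap.adjoint T.shift ^ b) x y
      = if T.pred^[a] x = T.pred^[b] y then (1 / T.m (T.pred^[a] x) : ℂ) else 0 := by
  have hadj : T.shift ^ a
      = ContinuousLinearMap.adjoint (ContinuousLinearMap.adjoint T.shift ^ a) := by
    simp only [← ContinuousLinearMap.star_eq_adjoint, star_pow, star_star]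
  rw [kernel_eq_inner, mul_apply_eq_comp, hadj,
    ContinuousLinearMap.adjoint_inner_right, adjoint_shift_pow_single, adjoint_shift_pow_single,
    inner_smul_left, inner_smul_right, inner_single_left, single_apply, map_div₀,
    Complex.conj_ofReal, Complex.conj_ofReal]
  have := T.m_ne_zero x
  have := T.m_ne_zero y
  have := T.m_ne_zero (T.pred^[a] x)
  have := T.m_ne_zero (T.pred^[b] y)
  split_ifs with h
  · rw [← h] at *
    field_simp
  · simp

/-- The sum of all words `Σ ^ a (Σ*) ^ b` with `a + b = n`. -/
noncomputable def wordSum (n : ℕ) : T.L2 →L[ℂ] T.L2 :=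
  ∑ p ∈ Finset.HasAntidiagonal.antidiagonal n, T.shift ^ p.1 * ContinuousLinearMap.adjoint T.shift ^ p.2

theorem wordSum_zero : T.wordSum 0 = 1 := by simp [wordSum]

theorem wordSum_one : T.wordSum 1 = T.shift + ContinuousLinearMap.adjoint T.shift := by
  simp [wordSum, Finset.Nat.antidiagonal_succ, add_comm]

/-- The recursion U_{n+2} = 2X U_{n+1} − U_n with 2X = Σ + Σ*. Left multiplication by Σ yields the
words of length n + 2 with a ≥ 1; left multiplication by Σ* yields the missing pure power of Σ* and,
through Σ*Σ = 1, the words of length n. -/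
theorem wordSum_add_two (n : ℕ) :
    T.wordSum (n + 2)
      = (T.shift + ContinuousLinearMap.adjoint T.shift) * T.wordSum (n + 1) - T.wordSum n := by
  have h1 : T.wordSum (n + 2) = T.shift * T.wordSum (n + 1)
      + ContinuousLinearMap.adjoint T.shift ^ (n + 2) := by
    rw [wordSum, Finset.Nat.antidiagonal_succ, Finset.sum_cons, Finset.sum_map, wordSum,
      Finset.mul_sum, add_comm]
    simp [pow_succ', mul_assoc]
  have h2 : ContinuousLinearMap.adjoint T.shift * T.wordSum (n + 1)
      = ContinuousLinearMap.adjoint T.shift ^ (n + 2) + T.wordSum n := by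
    rw [wordSum, Finset.Nat.antidiagonal_succ, Finset.sum_cons, Finset.sum_map, wordSum,
      mul_add, Finset.mul_sum]
    congr 1
    · simp [pow_succ']
    · refine Finset.sum_congr rfl fun p _ => ?_
      simp only [Function.Embedding.prodMap, Function.Embedding.coeFn_mk, Prod.map,
        Nat.succ_eq_add_one, Function.Embedding.refl_apply]
      rw [pow_succ', ← mul_assoc, ← mul_assoc, adjoint_shift_comp_shift, one_mul]
  rw [add_mul, h2, h1]
  abel

theorem laplacian_eq :
    T.laplacian = 1 - (1 / 2 : ℂ) • (T.shift + ContinuousLinearMap.adjoint T.shift) := by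
  have h1 : ContinuousLinearMap.adjoint T.gradient
      = 1 - ContinuousLinearMap.adjoint T.shift := by
    rw [gradient, map_sub, ContinuousLinearMap.adjoint_id]
    rfl
  have h2 : ContinuousLinearMap.adjoint T.gradient ∘L T.gradient
      = (2 : ℂ) • 1 - (T.shift + ContinuousLinearMap.adjoint T.shift) := by
    change ContinuousLinearMap.adjoint T.gradient * T.gradient = _
    rw [h1, gradient]
    change (1 - ContinuousLinearMap.adjoint T.shift) * (1 - T.shift) = _
    rw [sub_mul, mul_sub, mul_sub, adjoint_shift_comp_shift, two_smul]
    simp only [one_mul, mul_one]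
    abel
  rw [laplacian, h2, smul_sub, smul_smul]
  norm_num

theorem isSelfAdjoint_laplacian : IsSelfAdjoint T.laplacian := by
  have h : star T.laplacian = T.laplacian := by
    simp only [laplacian_eq, ← ContinuousLinearMap.star_eq_adjoint, star_sub, star_smul, star_add,
      star_star, star_one, add_comm (star T.shift)]
    simp
  exact h

theorem norm_laplacian_le : ‖T.laplacian‖ ≤ 2 := by
  have h : ‖T.gradient‖ ≤ 2 := by
    refine (norm_sub_le _ _).trans ?_
    have := T.norm_shift_le
    have h2 : ‖ContinuousLinearMap.id ℂ T.L2‖ ≤ 1 := ContinuousLinearMap.norm_id_le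
    linarith
  rw [laplacian, norm_smul]
  have h2 := ContinuousLinearMap.opNorm_comp_le (ContinuousLinearMap.adjoint T.gradient) T.gradient
  rw [LinearIsometryEquiv.norm_map] at h2
  have h3 : ‖(1 / 2 : ℂ)‖ = 1 / 2 := by norm_num
  rw [h3]
  nlinarith [norm_nonneg T.gradient]

end FlowTree

/-! ### Chebyshev coefficients of F. -/

open Polynomial in
-- Multiplication by X preserves the span, because X U_{n+1} = (U_{n+2} + U_n)/2 and X U_0 = U_1/2.
theorem mem_span_chebyshevU (P : ℝ[X]) :
    P ∈ Submodule.span ℝ (Set.range fun n : ℕ => Chebyshev.U ℝ n) := by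
  set S := Submodule.span ℝ (Set.range fun n : ℕ => Chebyshev.U ℝ n) with hS
  have hU : ∀ n : ℕ, Chebyshev.U ℝ n ∈ S := fun n => Submodule.subset_span ⟨n, rfl⟩
  have hX : ∀ Q ∈ S, X * Q ∈ S := by
    intro Q hQ
    induction hQ using Submodule.span_induction with
    | mem Q hQ =>
      obtain ⟨n, rfl⟩ := hQ
      rcases n with _ | n
      · have h : X * Chebyshev.U ℝ (0 : ℕ) = (1 / 2 : ℝ) • Chebyshev.U ℝ (1 : ℕ) := by
          simp [smul_eq_C_mul, ← mul_assoc, ← C_ofNat, ← C_mul]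
        change X * Chebyshev.U ℝ (0 : ℕ) ∈ S
        rw [h]
        exact S.smul_mem _ (hU 1)
      · have h : X * Chebyshev.U ℝ (n + 1 : ℕ)
            = (1 / 2 : ℝ) • (Chebyshev.U ℝ (n + 2 : ℕ) + Chebyshev.U ℝ n) := by
          have h2 : (1 / 2 : ℝ) • (2 : ℝ[X]) = 1 := by
            rw [smul_eq_C_mul, ← C_ofNat, ← C_mul]
            norm_num
          push_cast
          rw [Chebyshev.U_add_two, sub_add_cancel, mul_assoc, ← smul_mul_assoc, h2, one_mul]
        change X * Chebyshev.U ℝ (n + 1 : ℕ) ∈ S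
        rw [h]
        exact S.smul_mem _ (S.add_mem (hU _) (hU _))
    | zero => simp
    | add P Q _ _ hP hQ => rw [mul_add]; exact S.add_mem hP hQ
    | smul c P _ hP => rw [mul_smul_comm]; exact S.smul_mem _ hP
  have hpow : ∀ n : ℕ, (X ^ n : ℝ[X]) ∈ S := by
    intro n
    induction n with
    | zero => simpa using hU 0
    | succ n ih => rw [pow_succ']; exact hX _ ih
  rw [P.as_sum_range_C_mul_X_pow]
  refine S.sum_mem fun n _ => ?_
  rw [← smul_eq_C_mul]
  exact S.smul_mem _ (hpow n)

/-- Abel's inequality. -/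
theorem norm_sum_mul_le_of_antitone {h : ℕ → ℂ} {s : ℕ → ℝ} {B : ℝ} (hs : Antitone s)
    (hs0 : ∀ n, 0 ≤ s n) (hB : ∀ n, ‖∑ k ∈ Finset.range n, h k‖ ≤ B) (n : ℕ) :
    ‖∑ k ∈ Finset.range n, h k * s k‖ ≤ B * s 0 := by
  set H : ℕ → ℂ := fun n => ∑ k ∈ Finset.range n, h k with hH
  have hsum : ∑ k ∈ Finset.range n, h k * s k
      = H n * s n + ∑ k ∈ Finset.range n, H (k + 1) * (s k - s (k + 1)) := by
    induction n with
    | zero => simp [hH]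
    | succ n ih =>
      rw [Finset.sum_range_succ, ih, Finset.sum_range_succ]
      simp only [hH, Finset.sum_range_succ]
      ring
  have htel : ∑ k ∈ Finset.range n, (s k - s (k + 1)) = s 0 - s n := Finset.sum_range_sub' s n
  calc _ ≤ ‖H n * s n‖ + ∑ k ∈ Finset.range n, ‖H (k + 1) * (s k - s (k + 1))‖ := by
        rw [hsum]
        exact (norm_add_le _ _).trans (by gcongr; exact norm_sum_le _ _)
    _ ≤ B * s n + ∑ k ∈ Finset.range n, B * (s k - s (k + 1)) := by
        gcongr with k
        · rw [norm_mul, Complex.norm_real, Real.norm_of_nonneg (hs0 n)]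
          exact mul_le_mul_of_nonneg_right (hB n) (hs0 n)
        · rw [norm_mul, ← Complex.ofReal_sub, Complex.norm_real,
            Real.norm_of_nonneg (sub_nonneg.mpr (hs (Nat.le_succ k)))]
          exact mul_le_mul_of_nonneg_right (hB _) (sub_nonneg.mpr (hs (Nat.le_succ k)))
    _ = B * s 0 := by rw [← Finset.mul_sum, htel]; ring

/-- The cosine coefficients of `θ ↦ F (1 - cos θ)`. -/
noncomputable def cosCoeff (F : ℝ → ℂ) (n : ℕ) : ℂ :=
  (1 / Real.pi : ℂ) * ∫ θ in (0 : ℝ)..Real.pi, F (1 - Real.cos θ) * (Real.cos (n * θ) : ℂ)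

/-- The coefficient of the words of length `n` in the expansion of `F (𝓛)`. -/
noncomputable def wordCoeff (F : ℝ → ℂ) (n : ℕ) : ℂ := cosCoeff F n - cosCoeff F (n + 2)

theorem norm_cosCoeff_le {F : ℝ → ℂ} {M : ℝ} (hM : ∀ t ∈ Set.Icc (-2 : ℝ) 2, ‖F t‖ ≤ M) (n : ℕ) :
    ‖cosCoeff F n‖ ≤ M := by
  have h : ‖∫ θ in (0 : ℝ)..Real.pi, F (1 - Real.cos θ) * (Real.cos (n * θ) : ℂ)‖
      ≤ M * |Real.pi - 0| := by
    refine intervalIntegral.norm_integral_le_of_norm_le_const fun θ _ => ?_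
    have h1 := Real.cos_le_one θ
    have h2 := Real.neg_one_le_cos θ
    have h3 := hM (1 - Real.cos θ) ⟨by linarith, by linarith⟩
    rw [norm_mul, Complex.norm_real, Real.norm_eq_abs]
    have h4 := Real.abs_cos_le_one (n * θ)
    nlinarith [norm_nonneg (F (1 - Real.cos θ)), abs_nonneg (Real.cos (n * θ))]
  rw [sub_zero, abs_of_pos Real.pi_pos] at h
  rw [cosCoeff, norm_mul, norm_div, norm_one, Complex.norm_real,
    Real.norm_of_nonneg Real.pi_pos.le]
  have := Real.pi_pos
  calc _ ≤ 1 / Real.pi * (M * Real.pi) := by gcongr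
    _ = M := by field_simp

/-- The expansion of a kernel runs over indices of one parity, and `wordCoeff` is a difference with
the same step two: the sum telescopes, so no decay of the coefficients is involved. -/
theorem norm_sum_wordCoeff_le {F : ℝ → ℂ} {M : ℝ} (hM : ∀ t ∈ Set.Icc (-2 : ℝ) 2, ‖F t‖ ≤ M)
    (d n : ℕ) : ‖∑ k ∈ Finset.range n, wordCoeff F (d + 2 * k)‖ ≤ 2 * M := by
  have h : ∑ k ∈ Finset.range n, wordCoeff F (d + 2 * k)
      = cosCoeff F d - cosCoeff F (d + 2 * n) :=
    Finset.sum_range_sub' (fun k => cosCoeff F (d + 2 * k)) n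
  rw [h]
  have h1 := norm_cosCoeff_le hM d
  have h2 := norm_cosCoeff_le hM (d + 2 * n)
  exact (norm_sub_le _ _).trans (by linarith)

theorem intervalIntegrable_mul_cos {F : ℝ → ℂ} (hF : Continuous F) (n : ℕ) :
    IntervalIntegrable (fun θ => F (1 - Real.cos θ) * (Real.cos (n * θ) : ℂ)) volume
      0 Real.pi := by
  apply Continuous.intervalIntegrable
  fun_prop

theorem wordCoeff_add {F G : ℝ → ℂ} (hF : Continuous F) (hG : Continuous G) (n : ℕ) :
    wordCoeff (fun t => F t + G t) n = wordCoeff F n + wordCoeff G n := by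
  simp only [wordCoeff, cosCoeff, add_mul]
  rw [intervalIntegral.integral_add (intervalIntegrable_mul_cos hF _)
    (intervalIntegrable_mul_cos hG _), intervalIntegral.integral_add
    (intervalIntegrable_mul_cos hF _) (intervalIntegrable_mul_cos hG _)]
  ring

theorem wordCoeff_const_mul (F : ℝ → ℂ) (c : ℂ) (n : ℕ) :
    wordCoeff (fun t => c * F t) n = c * wordCoeff F n := by
  simp only [wordCoeff, cosCoeff, mul_assoc, intervalIntegral.integral_const_mul]
  ring

theorem integral_cos_natCast_mul (n : ℕ) :
    ∫ θ in (0 : ℝ)..Real.pi, Real.cos (n * θ) = if n = 0 then Real.pi else 0 := by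
  split_ifs with h
  · simp [h]
  · have hn : (n : ℝ) ≠ 0 := by exact_mod_cast h
    rw [intervalIntegral.integral_comp_mul_left _ hn, integral_cos]
    simp

/-- Since cos kθ − cos (k+2)θ = 2 sin (k+1)θ sin θ, `wordCoeff` is the coefficient (2/π)∫ F(1 − cos
θ) sin (k+1)θ sin θ dθ, and orthogonality of the sines applies. -/
theorem wordCoeff_chebyshevU (n k : ℕ) :
    wordCoeff (fun t => ((Polynomial.Chebyshev.U ℝ n).eval (1 - t) : ℝ)) k
      = if n = k then 1 else 0 := by
  have hc : Continuous fun t : ℝ => (((Polynomial.Chebyshev.U ℝ n).eval (1 - t) : ℝ) : ℂ) := by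
    fun_prop
  have key : ∀ θ : ℝ, (((Polynomial.Chebyshev.U ℝ n).eval (1 - (1 - Real.cos θ)) : ℝ) : ℂ)
        * (Real.cos (k * θ) : ℂ)
      - (((Polynomial.Chebyshev.U ℝ n).eval (1 - (1 - Real.cos θ)) : ℝ) : ℂ)
        * (Real.cos ((k + 2 : ℕ) * θ) : ℂ)
      -- Frequencies are made natural numbers by evenness of cosine; the first vanishes only for n =
      -- k, the second never does.
      = ((Real.cos (((n : ℤ) - k).natAbs * θ) - Real.cos ((n + k + 2 : ℕ) * θ) : ℝ) : ℂ) := by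
    intro θ
    have h1 := Polynomial.Chebyshev.U_real_cos θ n
    have h2 : Real.cos (((n : ℤ) - k).natAbs * θ) = Real.cos ((n - k) * θ) := by
      rw [Nat.cast_natAbs]
      push_cast
      rcases abs_choice ((n : ℝ) - k) with h | h
      · rw [h]
      · rw [h, neg_mul, Real.cos_neg]
    rw [h2, sub_sub_cancel]
    rw [← mul_sub]
    norm_cast
    push_cast at h1 ⊢
    have h3 : Real.cos (k * θ) - Real.cos ((k + 2) * θ)
        = 2 * Real.sin ((k + 1) * θ) * Real.sin θ := by
      rw [show (k : ℝ) * θ = (k + 1) * θ - θ by ring,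
        show ((k : ℝ) + 2) * θ = (k + 1) * θ + θ by ring, Real.cos_sub, Real.cos_add]
      ring
    have h4 : Real.cos ((n - k) * θ) - Real.cos ((n + k + 2) * θ)
        = 2 * Real.sin ((k + 1) * θ) * Real.sin ((n + 1) * θ) := by
      rw [show ((n : ℝ) - k) * θ = (n + 1) * θ - (k + 1) * θ by ring,
        show ((n : ℝ) + k + 2) * θ = (n + 1) * θ + (k + 1) * θ by ring, Real.cos_sub, Real.cos_add]
      ring
    rw [h3, h4, ← h1]
    ring
  have hpi : (Real.pi : ℂ) ≠ 0 := by exact_mod_cast Real.pi_ne_zero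
  have hint : ∀ m : ℕ, IntervalIntegrable (fun θ : ℝ => Real.cos (m * θ)) volume 0 Real.pi :=
    fun m => Continuous.intervalIntegrable (by fun_prop) _ _
  rw [wordCoeff, cosCoeff, cosCoeff, ← mul_sub, ← intervalIntegral.integral_sub
    (intervalIntegrable_mul_cos hc _) (intervalIntegrable_mul_cos hc _),
    intervalIntegral.integral_congr fun θ _ => key θ, intervalIntegral.integral_ofReal,
    intervalIntegral.integral_sub (hint _) (hint _), integral_cos_natCast_mul,
    integral_cos_natCast_mul]
  have h0 : ((n : ℤ) - k).natAbs = 0 ↔ n = k := by omega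
  simp only [h0]
  split_ifs <;> simp_all

/-! ### Functional calculus and the expansion of the kernel. -/

namespace FlowTree

variable (T : FlowTree)

theorem spectrum_laplacian {z : ℂ} (hz : z ∈ spectrum ℂ T.laplacian) :
    z = z.re ∧ z.re ∈ Set.Icc (-2 : ℝ) 2 := by
  refine ⟨T.isSelfAdjoint_laplacian.mem_spectrum_eq_re hz, ?_⟩
  have h1 : ‖(1 : T.L2 →L[ℂ] T.L2)‖ ≤ 1 := ContinuousLinearMap.norm_id_le
  have h2 := spectrum.norm_le_norm_mul_of_mem hz
  have h3 : ‖z‖ ≤ 2 := h2.trans (by nlinarith [T.norm_laplacian_le, norm_nonneg T.laplacian])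
  exact abs_le.mp ((Complex.abs_re_le_norm z).trans h3)

theorem isStarNormal_laplacian : IsStarNormal T.laplacian :=
  T.isSelfAdjoint_laplacian.isStarNormal

theorem functionOfLaplacian_add {F G : ℝ → ℂ} (hF : Continuous F) (hG : Continuous G) :
    T.functionOfLaplacian (fun t => F t + G t)
      = T.functionOfLaplacian F + T.functionOfLaplacian G :=
  cfc_add T.laplacian (fun z : ℂ => F z.re) (fun z : ℂ => G z.re)
    (by fun_prop) (by fun_prop)

theorem functionOfLaplacian_const_mul {F : ℝ → ℂ} (hF : Continuous F) (c : ℂ) :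
    T.functionOfLaplacian (fun t => c * F t) = c • T.functionOfLaplacian F :=
  cfc_const_mul c (fun z : ℂ => F z.re) T.laplacian (by fun_prop)

theorem norm_functionOfLaplacian_sub_le {F G : ℝ → ℂ} (hF : Continuous F) (hG : Continuous G)
    {δ : ℝ} (hδ : ∀ t ∈ Set.Icc (-2 : ℝ) 2, ‖F t - G t‖ ≤ δ) :
    ‖T.functionOfLaplacian F - T.functionOfLaplacian G‖ ≤ δ := by
  have h : T.functionOfLaplacian F - T.functionOfLaplacian G
      = cfc (fun z : ℂ => F z.re - G z.re) T.laplacian :=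
    (cfc_sub (fun z : ℂ => F z.re) (fun z : ℂ => G z.re) T.laplacian
      (by fun_prop) (by fun_prop)).symm
  rw [h]
  exact norm_cfc_le ((norm_nonneg _).trans (hδ 0 (by norm_num)))
    fun z hz => hδ _ (T.spectrum_laplacian hz).2

open Polynomial in
theorem aeval_chebyshevU_one_sub_laplacian (n : ℕ) :
    aeval (1 - T.laplacian) (Chebyshev.U ℂ n) = T.wordSum n := by
  have h1 : (2 : T.L2 →L[ℂ] T.L2) * (1 - T.laplacian)
      = T.shift + ContinuousLinearMap.adjoint T.shift := by
    rw [laplacian_eq, sub_sub_cancel, mul_smul_comm, two_mul, ← two_smul ℂ, smul_smul]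
    norm_num
  have key : aeval (1 - T.laplacian) (Chebyshev.U ℂ n) = T.wordSum n ∧
      aeval (1 - T.laplacian) (Chebyshev.U ℂ (n + 1 : ℕ)) = T.wordSum (n + 1) := by
    induction n with
    | zero =>
      have h2 : aeval (1 - T.laplacian) (2 : ℂ[X]) = 2 := map_ofNat _ 2
      simp [wordSum_zero, wordSum_one, h1, h2]
    | succ n ih =>
      refine ⟨ih.2, ?_⟩
      have h2 := ih.2
      push_cast at h2 ⊢
      rw [add_assoc, show (1 : ℤ) + 1 = 2 by norm_num, Chebyshev.U_add_two, map_sub, map_mul,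
        map_mul, h2, ih.1, aeval_X, map_ofNat, h1]
      exact (T.wordSum_add_two n).symm
  exact key.1

open Polynomial in
theorem functionOfLaplacian_chebyshevU (n : ℕ) :
    T.functionOfLaplacian (fun t => ((Chebyshev.U ℝ n).eval (1 - t) : ℝ)) = T.wordSum n := by
  have h := T.isStarNormal_laplacian
  have h1 : T.functionOfLaplacian (fun t => ((Chebyshev.U ℝ n).eval (1 - t) : ℝ))
      = cfc ((Chebyshev.U ℂ n).comp (1 - X)).eval T.laplacian := by
    refine cfc_congr fun z hz => ?_
    change (((Chebyshev.U ℝ n).eval (1 - z.re) : ℝ) : ℂ) = _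
    rw [Chebyshev.complex_ofReal_eval_U, eval_comp]
    conv_rhs => rw [(T.spectrum_laplacian hz).1]
    simp
  rw [h1, cfc_polynomial _ _ h, aeval_comp, ← aeval_chebyshevU_one_sub_laplacian]
  simp

/-- The partial sums of the kernel of `F (𝓛)` at `(x, y)`, where `z` is the confluent of `x` and
`y`, and `d` is their distance. -/
noncomputable def kernelSum (F : ℝ → ℂ) (z : T.V) (d n : ℕ) : ℂ :=
  ∑ k ∈ Finset.range n, wordCoeff F (d + 2 * k) * ((1 / T.m (T.pred^[k] z) : ℝ) : ℂ)

theorem antitone_one_div_m (z : T.V) : Antitone fun k => 1 / T.m (T.pred^[k] z) :=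
  fun _ _ h => one_div_le_one_div_of_le (T.m_pos _) (T.monotone_m_pred_iterate z h)

/-- Abel's inequality with the decreasing factors 1/m(𝔭^k z). The bound is uniform in n and linear
in the supremum of F, which is what the passage from polynomials to continuous functions requires.
-/
theorem norm_kernelSum_le {F : ℝ → ℂ} {M : ℝ} (hM : ∀ t ∈ Set.Icc (-2 : ℝ) 2, ‖F t‖ ≤ M)
    (z : T.V) (d n : ℕ) : ‖T.kernelSum F z d n‖ ≤ 2 * M / T.m z := by
  have h := norm_sum_mul_le_of_antitone (T.antitone_one_div_m z)
    (fun n => (one_div_pos.mpr (T.m_pos _)).le) (norm_sum_wordCoeff_le hM d) n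
  rwa [Function.iterate_zero_apply, mul_one_div] at h

/-- A tail is a partial sum of the same kind begun at a higher ancestor, hence falls under
`norm_kernelSum_le`. -/
theorem kernelSum_add (F : ℝ → ℂ) (z : T.V) (d J n : ℕ) :
    T.kernelSum F z d (J + n)
      = T.kernelSum F z d J + T.kernelSum F (T.pred^[J] z) (d + 2 * J) n := by
  rw [kernelSum, Finset.sum_range_add, kernelSum, kernelSum]
  congr 1
  refine Finset.sum_congr rfl fun k _ => ?_
  rw [← Function.iterate_add_apply, add_comm k, mul_add, add_assoc]

variable {T}

open Classical in
-- The only words seen at (x, y) are those with exponents (a + k, b + k), and the length n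
-- determines k.
theorem kernel_wordSum {x y : T.V} {a b : ℕ} (h : T.IsConfluent x y a b) (n : ℕ) :
    T.kernel (T.wordSum n) x y = if ∃ k, n = a + b + 2 * k
      then ((1 / T.m (T.pred^[(n - (a + b)) / 2] (T.pred^[a] x)) : ℝ) : ℂ) else 0 := by
  rw [wordSum, kernel_sum]
  simp only [kernel_shift_pow_mul]
  split_ifs with hn
  · obtain ⟨k, rfl⟩ := hn
    rw [Finset.sum_eq_single (a + k, b + k)]
    · rw [if_pos (InftyRootedTree.pred_iterate_add_eq h.1 k), ← Function.iterate_add_apply,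
        show (a + b + 2 * k - (a + b)) / 2 + a = a + k by omega]
      push_cast
      rfl
    · rintro ⟨a', b'⟩ hmem hne
      refine if_neg fun h' => hne ?_
      obtain ⟨k', rfl, rfl⟩ := h.2 _ _ h'
      rw [Finset.HasAntidiagonal.mem_antidiagonal] at hmem
      dsimp only at hmem
      rw [show k' = k by omega]
    · intro hmem
      exact absurd (Finset.HasAntidiagonal.mem_antidiagonal.mpr (by dsimp only; omega)) hmem
  · refine Finset.sum_eq_zero fun p hp => if_neg fun h' => hn ?_
    obtain ⟨k, h1, h2⟩ := h.2 _ _ h'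
    rw [Finset.HasAntidiagonal.mem_antidiagonal] at hp
    exact ⟨k, by omega⟩

theorem tendsto_kernelSum_chebyshevU {x y : T.V} {a b : ℕ} (h : T.IsConfluent x y a b) (n : ℕ) :
    Tendsto (T.kernelSum (fun t => ((Polynomial.Chebyshev.U ℝ n).eval (1 - t) : ℝ))
      (T.pred^[a] x) (a + b)) atTop (𝓝 (T.kernel (T.functionOfLaplacian
        fun t => ((Polynomial.Chebyshev.U ℝ n).eval (1 - t) : ℝ)) x y)) := by
  rw [functionOfLaplacian_chebyshevU, kernel_wordSum h]
  refine tendsto_const_nhds.congr' ?_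
  filter_upwards [eventually_gt_atTop n] with N hN
  simp only [kernelSum, wordCoeff_chebyshevU]
  split_ifs with hn
  · obtain ⟨k, rfl⟩ := hn
    rw [Finset.sum_eq_single k]
    · rw [if_pos rfl, one_mul, show (a + b + 2 * k - (a + b)) / 2 = k by omega]
    · intro j _ hj
      rw [if_neg (by omega), zero_mul]
    · intro hk
      exact absurd (Finset.mem_range.mpr (by omega)) hk
  · symm
    refine Finset.sum_eq_zero fun k _ => ?_
    rw [if_neg fun h' => hn ⟨k, h'⟩, zero_mul]

theorem tendsto_kernelSum_add {F G : ℝ → ℂ} (hF : Continuous F) (hG : Continuous G)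
    {x y z : T.V} {d : ℕ}
    (h1 : Tendsto (T.kernelSum F z d) atTop (𝓝 (T.kernel (T.functionOfLaplacian F) x y)))
    (h2 : Tendsto (T.kernelSum G z d) atTop (𝓝 (T.kernel (T.functionOfLaplacian G) x y))) :
    Tendsto (T.kernelSum (fun t => F t + G t) z d) atTop
      (𝓝 (T.kernel (T.functionOfLaplacian fun t => F t + G t) x y)) := by
  rw [T.functionOfLaplacian_add hF hG, kernel_add]
  refine (h1.add h2).congr fun n => ?_
  simp only [kernelSum, wordCoeff_add hF hG, add_mul, Finset.sum_add_distrib]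

theorem tendsto_kernelSum_const_mul {F : ℝ → ℂ} (hF : Continuous F) (c : ℂ)
    {x y z : T.V} {d : ℕ}
    (h : Tendsto (T.kernelSum F z d) atTop (𝓝 (T.kernel (T.functionOfLaplacian F) x y))) :
    Tendsto (T.kernelSum (fun t => c * F t) z d) atTop
      (𝓝 (T.kernel (T.functionOfLaplacian fun t => c * F t) x y)) := by
  rw [T.functionOfLaplacian_const_mul hF, kernel_smul]
  refine (h.const_mul c).congr fun n => ?_
  simp only [kernelSum, wordCoeff_const_mul, Finset.mul_sum, mul_assoc]

open Polynomial in
theorem tendsto_kernelSum_polynomial {x y : T.V} {a b : ℕ} (h : T.IsConfluent x y a b)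
    (P : ℝ[X]) :
    Tendsto (T.kernelSum (fun t => (P.eval (1 - t) : ℝ)) (T.pred^[a] x) (a + b)) atTop
      (𝓝 (T.kernel (T.functionOfLaplacian fun t => (P.eval (1 - t) : ℝ)) x y)) := by
  have hc : ∀ Q : ℝ[X], Continuous fun t : ℝ => ((Q.eval (1 - t) : ℝ) : ℂ) := fun Q => by fun_prop
  induction mem_span_chebyshevU P using Submodule.span_induction with
  | mem Q hQ =>
    obtain ⟨n, rfl⟩ := hQ
    exact tendsto_kernelSum_chebyshevU h n
  | zero =>
    have := tendsto_kernelSum_const_mul (hc _) 0 (tendsto_kernelSum_chebyshevU h 0)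
    simpa using this
  | add P Q _ _ hP hQ =>
    have := tendsto_kernelSum_add (hc P) (hc Q) hP hQ
    simpa using this
  | smul c P _ hP =>
    have := tendsto_kernelSum_const_mul (hc P) c hP
    simpa using this

open Polynomial in
theorem exists_polynomial_near_complex {F : ℝ → ℂ} (hF : Continuous F) {δ : ℝ} (hδ : 0 < δ) :
    ∃ P Q : ℝ[X], ∀ t ∈ Set.Icc (-2 : ℝ) 2,
      ‖F t - ((P.eval (1 - t) : ℝ) + Complex.I * (Q.eval (1 - t) : ℝ))‖ ≤ δ := by
  obtain ⟨P, hP⟩ := exists_polynomial_near_of_continuousOn (-1) 3 (fun u => (F (1 - u)).re)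
    (by fun_prop) (δ / 2) (half_pos hδ)
  obtain ⟨Q, hQ⟩ := exists_polynomial_near_of_continuousOn (-1) 3 (fun u => (F (1 - u)).im)
    (by fun_prop) (δ / 2) (half_pos hδ)
  refine ⟨P, Q, fun t ht => ?_⟩
  -- The interval [−2, 2] comes from ‖𝓛‖ ≤ 2; the substitution u = 1 − t turns it into [−1, 3].
  have hmem : 1 - t ∈ Set.Icc (-1 : ℝ) 3 := ⟨by linarith [ht.2], by linarith [ht.1]⟩
  have h1 := hP _ hmem
  have h2 := hQ _ hmem
  simp only [sub_sub_cancel] at h1 h2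
  refine (Complex.norm_le_abs_re_add_abs_im _).trans ?_
  rw [abs_sub_comm] at h1 h2
  simp only [Complex.sub_re, Complex.add_re, Complex.ofReal_re, Complex.mul_re, Complex.I_re,
    Complex.I_im, Complex.ofReal_im, Complex.sub_im, Complex.add_im, Complex.mul_im]
  ring_nf at h1 h2 ⊢
  linarith

/-- The kernel of `F (𝓛)` is the (conditionally convergent) sum of its expansion. -/
theorem tendsto_kernelSum {F : ℝ → ℂ} (hF : Continuous F) {x y : T.V} {a b : ℕ}
    (h : T.IsConfluent x y a b) :
    Tendsto (T.kernelSum F (T.pred^[a] x) (a + b)) atTop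
      (𝓝 (T.kernel (T.functionOfLaplacian F) x y)) := by
  set z := T.pred^[a] x with hz
  set D : ℝ := ‖T.single x‖ * ‖T.single y‖ / (T.m x * T.m y) with hD
  have hD0 : 0 ≤ D := by
    have := T.m_pos x
    have := T.m_pos y
    positivity
  have hmz := T.m_pos z
  rw [Metric.tendsto_atTop]
  intro ε hε
  -- Replacing F by a δ-close polynomial function costs 2δ/m(z) in the partial sums and δD in the
  -- kernel, together at most ε/2.
  set δ : ℝ := ε / (2 * (2 / T.m z + D + 1)) with hδ
  have hpos : 0 < 2 / T.m z + D + 1 := by positivity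
  have hδ0 : 0 < δ := by positivity
  obtain ⟨P, Q, hPQ⟩ := exists_polynomial_near_complex hF hδ0
  set G : ℝ → ℂ := fun t => (P.eval (1 - t) : ℝ) + Complex.I * (Q.eval (1 - t) : ℝ) with hG
  have hGc : Continuous G := by fun_prop
  have hlim : Tendsto (T.kernelSum G z (a + b)) atTop
      (𝓝 (T.kernel (T.functionOfLaplacian G) x y)) :=
    tendsto_kernelSum_add (by fun_prop) (by fun_prop) (tendsto_kernelSum_polynomial h P)
      (tendsto_kernelSum_const_mul (by fun_prop) _ (tendsto_kernelSum_polynomial h Q))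
  obtain ⟨N, hN⟩ := Metric.tendsto_atTop.mp hlim (ε / 2) (half_pos hε)
  refine ⟨N, fun n hn => ?_⟩
  have h1 : ‖T.kernelSum F z (a + b) n - T.kernelSum G z (a + b) n‖ ≤ 2 * δ / T.m z := by
    have h2 := T.norm_kernelSum_le (F := fun t => F t + (-1) * G t) (M := δ)
      (fun t ht => by rw [neg_one_mul, ← sub_eq_add_neg]; exact hPQ t ht) z (a + b) n
    have h3 : T.kernelSum (fun t => F t + (-1) * G t) z (a + b) n
        = T.kernelSum F z (a + b) n - T.kernelSum G z (a + b) n := by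
      simp only [kernelSum, ← Finset.sum_sub_distrib]
      refine Finset.sum_congr rfl fun k _ => ?_
      rw [wordCoeff_add hF (by fun_prop), wordCoeff_const_mul]
      ring
    rwa [h3] at h2
  have h2 : ‖T.kernel (T.functionOfLaplacian F) x y - T.kernel (T.functionOfLaplacian G) x y‖
      ≤ δ * D :=
    (T.norm_kernel_sub_le _ _ x y).trans
      (mul_le_mul_of_nonneg_right (T.norm_functionOfLaplacian_sub_le hF hGc hPQ) hD0)
  have h3 := hN n hn
  have h4 : δ * (2 / T.m z + D + 1) = ε / 2 := by
    rw [hδ]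
    field_simp
  rw [dist_eq_norm] at h3 ⊢
  have h5 : T.kernelSum F z (a + b) n - T.kernel (T.functionOfLaplacian F) x y
      = (T.kernelSum F z (a + b) n - T.kernelSum G z (a + b) n)
        + (T.kernelSum G z (a + b) n - T.kernel (T.functionOfLaplacian G) x y)
        - (T.kernel (T.functionOfLaplacian F) x y - T.kernel (T.functionOfLaplacian G) x y) := by
    ring
  rw [h5]
  refine (norm_sub_le _ _).trans_lt ?_
  have h6 := norm_add_le (T.kernelSum F z (a + b) n - T.kernelSum G z (a + b) n)
    (T.kernelSum G z (a + b) n - T.kernel (T.functionOfLaplacian G) x y)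
  have h7 : 2 * δ / T.m z = δ * (2 / T.m z) := by ring
  nlinarith

/-- The tail starts at 𝔭^{a+J} x and is controlled by the mass there; on a homogeneous tree this
mass carries the factor q^J that makes tails small. -/
theorem norm_kernel_sub_kernelSum_le {F : ℝ → ℂ} (hF : Continuous F) {M : ℝ}
    (hM : ∀ t ∈ Set.Icc (-2 : ℝ) 2, ‖F t‖ ≤ M) {x y : T.V} {a b : ℕ}
    (h : T.IsConfluent x y a b) (J : ℕ) :
    ‖T.kernel (T.functionOfLaplacian F) x y - T.kernelSum F (T.pred^[a] x) (a + b) J‖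
      ≤ 2 * M / T.m (T.pred^[a + J] x) := by
  have h1 := (tendsto_kernelSum hF h).comp (tendsto_add_atTop_nat J)
  refine le_of_tendsto (h1.sub_const _).norm (Eventually.of_forall fun n => ?_)
  rw [Function.comp_apply, add_comm n, kernelSum_add, add_sub_cancel_left, add_comm a J,
    Function.iterate_add_apply]
  exact T.norm_kernelSum_le hM _ _ _

end FlowTree

/-! ### The weighted kernel norm. -/

theorem exists_norm_le_of_continuous {F : ℝ → ℂ} (hF : Continuous F) :
    ∃ M : ℝ, ∀ t ∈ Set.Icc (-2 : ℝ) 2, ‖F t‖ ≤ M :=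
  isCompact_Icc.exists_bound_of_continuousOn hF.continuousOn

theorem tendsto_one_div_pnat (c : ℝ) : Tendsto (fun q : ℕ+ => c / (q : ℝ)) atTop (𝓝 0) := by
  have h : Tendsto (fun q : ℕ+ => ((q : ℕ) : ℝ)) atTop atTop :=
    tendsto_natCast_atTop_atTop.comp tendsto_PNat_val_atTop_atTop
  exact h.const_div_atTop c

namespace FlowTree

variable {T : FlowTree}

open Classical in
theorem tsum_ite_pred_iterate (T : FlowTree) (a : ℕ) (z : T.V) :
    ∑' x : T.V, (if T.pred^[a] x = z then ENNReal.ofReal (T.m x) else 0)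
      = ENNReal.ofReal (T.m z) := by
  have h := T.measure_preimage_pred_iterate a {z}
  rw [measure_singleton, measure_apply] at h
  rw [← h]
  refine tsum_congr fun x => ?_
  rw [Set.indicator_apply]
  rfl

open Classical in
theorem enorm_kernel_le_tsum {F : ℝ → ℂ} (hF : Continuous F) (x y : T.V) :
    ‖T.kernel (T.functionOfLaplacian F) x y‖ₑ ≤ ∑' p : ℕ × ℕ,
      if T.pred^[p.1] x = T.pred^[p.2] y
        then ‖wordCoeff F (p.1 + p.2)‖ₑ * (ENNReal.ofReal (T.m (T.pred^[p.2] y)))⁻¹ else 0 := by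
  obtain ⟨a, b, h⟩ := T.exists_isConfluent x y
  refine le_of_tendsto (tendsto_kernelSum hF h).enorm (Eventually.of_forall fun n => ?_)
  have hinj : Function.Injective fun k : ℕ => (a + k, b + k) := fun k k' hk => by
    simpa using congrArg Prod.fst hk
  refine le_trans ?_ (ENNReal.tsum_comp_le_tsum_of_injective hinj _)
  refine le_trans ?_ (ENNReal.sum_le_tsum (Finset.range n))
  refine (enorm_sum_le _ _).trans (Finset.sum_le_sum fun k _ => ?_)
  have h1 := InftyRootedTree.pred_iterate_add_eq h.1 k
  have h2 : T.pred^[k] (T.pred^[a] x) = T.pred^[b + k] y := by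
    rw [← h1, add_comm a, Function.iterate_add_apply]
  rw [if_pos h1, h2, enorm_mul, show a + k + (b + k) = a + b + 2 * k by ring,
    ← ENNReal.ofReal_inv_of_pos (T.m_pos _), one_div, ← ofReal_norm (Complex.ofReal _),
    Complex.norm_real, Real.norm_of_nonneg (inv_nonneg.mpr (T.m_pos _).le)]

/-- After exchanging the sums, the x with 𝔭^a x = 𝔭^b y have total mass m(𝔭^b y) by the flow
property, which cancels the kernel of the word. As d(x, y) ≤ a + b, monotonicity of w applies. What
is left depends on T only through the level of y. -/
theorem tsum_weight_mul_kernel_le {F : ℝ → ℂ} (hF : Continuous F) {w : ℕ → ℤ → ℤ → ℝ≥0}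
    (hw : ∀ k l : ℤ, Monotone fun n : ℕ => w n k l) (y : T.V) :
    ∑' x : T.V, (w (T.graph.dist x y) (T.level x) (T.level y) : ℝ≥0∞) *
        ‖T.kernel (T.functionOfLaplacian F) x y‖ₑ * ENNReal.ofReal (T.m x)
      ≤ ∑' p : ℕ × ℕ, (w (p.1 + p.2) (T.level y + p.2 - p.1) (T.level y) : ℝ≥0∞) *
        ‖wordCoeff F (p.1 + p.2)‖ₑ := by
  classical
  calc _ ≤ ∑' x : T.V, ∑' p : ℕ × ℕ,
        (w (p.1 + p.2) (T.level y + p.2 - p.1) (T.level y) : ℝ≥0∞) *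
          ‖wordCoeff F (p.1 + p.2)‖ₑ * (ENNReal.ofReal (T.m (T.pred^[p.2] y)))⁻¹ *
          (if T.pred^[p.1] x = T.pred^[p.2] y then ENNReal.ofReal (T.m x) else 0) := by
        refine ENNReal.tsum_le_tsum fun x => ?_
        rw [mul_right_comm]
        refine (mul_le_mul_right (enorm_kernel_le_tsum hF x y) _).trans ?_
        rw [← ENNReal.tsum_mul_left]
        refine ENNReal.tsum_le_tsum fun p => ?_
        split_ifs with h
        · have h1 := T.level_eq_of_pred_iterate_eq h
          rw [show T.level x = T.level y + p.2 - p.1 by omega]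
          have h2 : (w (T.graph.dist x y) (T.level y + p.2 - p.1) (T.level y) : ℝ≥0∞)
              ≤ w (p.1 + p.2) (T.level y + p.2 - p.1) (T.level y) :=
            ENNReal.coe_le_coe.mpr (hw _ _ (T.dist_le_of_pred_iterate_eq h))
          calc _ ≤ (w (p.1 + p.2) (T.level y + p.2 - p.1) (T.level y) : ℝ≥0∞)
                * ENNReal.ofReal (T.m x) * (‖wordCoeff F (p.1 + p.2)‖ₑ *
                (ENNReal.ofReal (T.m (T.pred^[p.2] y)))⁻¹) := by gcongr
            _ = _ := by ring
        · simp
    _ = _ := by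
        rw [ENNReal.tsum_comm]
        refine tsum_congr fun p => ?_
        rw [ENNReal.tsum_mul_left, tsum_ite_pred_iterate, mul_assoc, ENNReal.inv_mul_cancel,
          mul_one]
        · simpa using T.m_pos _
        · exact ENNReal.ofReal_ne_top

namespace IsCanonicalHomogeneous

variable {q : ℕ+} (hT : T.IsCanonicalHomogeneous q)
include hT

theorem m_pred (x : T.V) : T.m (T.pred x) = q * T.m x := by
  rw [hT.2, hT.2, InftyRootedTree.level_pred, zpow_add_one₀ (by exact_mod_cast q.ne_zero),
    mul_comm]

theorem exists_level_eq (l : ℤ) : ∃ y : T.V, T.level y = l := by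
  obtain ⟨x⟩ := T.isTree.connected.nonempty
  have hdown : ∀ n : ℕ, ∃ y : T.V, T.level y = T.level x - n := by
    intro n
    induction n with
    | zero => exact ⟨x, by simp⟩
    | succ n ih =>
      obtain ⟨y, hy⟩ := ih
      obtain ⟨z, hz⟩ : (T.succ y).Nonempty := by
        apply Set.nonempty_of_ncard_ne_zero
        rw [hT.1]
        exact q.ne_zero
      refine ⟨z, ?_⟩
      have h := T.level_pred z
      rw [show T.pred z = y from hz] at h
      push_cast
      omega
  rcases le_total l (T.level x) with h | h
  · obtain ⟨y, hy⟩ := hdown (T.level x - l).toNat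
    exact ⟨y, by omega⟩
  · exact ⟨T.pred^[(l - T.level x).toNat] x, by rw [InftyRootedTree.level_pred_iterate]; omega⟩

/-- The x with 𝔭^a x = 𝔭^b y have mass m(𝔭^b y). Those meeting y earlier lie below 𝔭^{b−1} y, a
single one of the q successors, and carry a fraction 1/q; there are none if a = 0 or b = 0. -/
theorem le_measure_isConfluent (y : T.V) (a b : ℕ) :
    ENNReal.ofReal (T.m (T.pred^[b] y) * (1 - 1 / q))
      ≤ T.measure {x | T.IsConfluent x y a b} := by
  have hq : (0 : ℝ) < q := by exact_mod_cast q.pos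
  have hm := T.m_pos (T.pred^[b] y)
  have h1 : T.measure {x | T.pred^[a] x = T.pred^[b] y}
      = ENNReal.ofReal (T.m (T.pred^[b] y)) := by
    rw [← measure_singleton]
    exact T.measure_preimage_pred_iterate a {T.pred^[b] y}
  have h2 : T.measure {x | T.pred^[a] x = T.pred^[b] y}
      ≤ T.measure {x | T.IsConfluent x y a b}
        + ENNReal.ofReal (T.m (T.pred^[b] y) / q) := by
    rcases a with _ | a
    · refine le_add_right (measure_mono fun x hx => ?_)
      exact InftyRootedTree.isConfluent_of_forall hx fun a' b' ha => absurd ha (by omega)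
    rcases b with _ | b
    · refine le_add_right (measure_mono fun x hx => ?_)
      exact InftyRootedTree.isConfluent_of_forall hx fun a' b' _ hb => absurd hb (by omega)
    have h3 : T.m (T.pred^[b + 1] y) / q = T.m (T.pred^[b] y) := by
      rw [Function.iterate_succ_apply', hT.m_pred]
      field_simp
    rw [h3, ← T.measure_singleton, ← T.measure_preimage_pred_iterate a {_}]
    refine (measure_mono fun x hx => ?_).trans (measure_union_le _ _)
    by_cases h : T.pred^[a] x = T.pred^[b] y
    · exact Or.inr h
    · refine Or.inl (InftyRootedTree.isConfluent_of_forall hx fun a' b' ha hb => ?_)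
      obtain rfl : a = a' := by omega
      obtain rfl : b = b' := by omega
      exact h
  rw [h1, add_comm] at h2
  rw [show T.m (T.pred^[b] y) * (1 - 1 / q)
    = T.m (T.pred^[b] y) - T.m (T.pred^[b] y) / q by ring, ENNReal.ofReal_sub _ (by positivity)]
  exact tsub_le_iff_left.mpr h2

/-- Only the first term of the expansion is kept: the tail starts one generation higher, where the
mass is q times larger. -/
theorem le_enorm_kernel {F : ℝ → ℂ} (hF : Continuous F) {M : ℝ}
    (hM : ∀ t ∈ Set.Icc (-2 : ℝ) 2, ‖F t‖ ≤ M) {x y : T.V} {a b : ℕ}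
    (h : T.IsConfluent x y a b) :
    ENNReal.ofReal ((‖wordCoeff F (a + b)‖ - 2 * M / q) / T.m (T.pred^[b] y))
      ≤ ‖T.kernel (T.functionOfLaplacian F) x y‖ₑ := by
  have hq : (0 : ℝ) < q := by exact_mod_cast q.pos
  have hm := T.m_pos (T.pred^[b] y)
  have h1 := norm_kernel_sub_kernelSum_le hF hM h 1
  rw [Function.iterate_succ_apply', h.1, hT.m_pred, kernelSum, Finset.sum_range_one, mul_zero,
    add_zero, Function.iterate_zero_apply] at h1
  have h2 : ‖wordCoeff F (a + b) * ((1 / T.m (T.pred^[b] y) : ℝ) : ℂ)‖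
      = ‖wordCoeff F (a + b)‖ / T.m (T.pred^[b] y) := by
    rw [norm_mul, Complex.norm_real, Real.norm_of_nonneg (by positivity), mul_one_div]
  have h3 := norm_sub_norm_le (wordCoeff F (a + b) * ((1 / T.m (T.pred^[b] y) : ℝ) : ℂ))
    (T.kernel (T.functionOfLaplacian F) x y)
  rw [norm_sub_rev, h2] at h3
  rw [← ofReal_norm]
  refine ENNReal.ofReal_le_ofReal ?_
  rw [sub_div, div_div]
  linarith

/-- Each x has exactly one confluent pair with y, so splitting the sum by pairs counts nothing
twice. A negative lower bound is harmless because `ENNReal.ofReal` sends it to 0. -/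
theorem le_tsum_weight_mul_kernel {F : ℝ → ℂ} (hF : Continuous F) {M : ℝ}
    (hM : ∀ t ∈ Set.Icc (-2 : ℝ) 2, ‖F t‖ ≤ M) {w : ℕ → ℤ → ℤ → ℝ≥0}
    (hw : ∀ k l : ℤ, Monotone fun n : ℕ => w n k l) (y : T.V) :
    ∑' p : ℕ × ℕ, (w (p.1 + p.2) (T.level y + p.2 - p.1) (T.level y) : ℝ≥0∞) *
        ENNReal.ofReal ((‖wordCoeff F (p.1 + p.2)‖ - 2 * M / q) * (1 - 1 / q))
      ≤ ∑' x : T.V, (w (T.graph.dist x y) (T.level x) (T.level y) : ℝ≥0∞) *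
        ‖T.kernel (T.functionOfLaplacian F) x y‖ₑ * ENNReal.ofReal (T.m x) := by
  classical
  have hq : (1 : ℝ) ≤ q := by exact_mod_cast q.pos
  calc _ ≤ ∑' p : ℕ × ℕ, ∑' x : T.V, if T.IsConfluent x y p.1 p.2 then
        (w (T.graph.dist x y) (T.level x) (T.level y) : ℝ≥0∞) *
        ‖T.kernel (T.functionOfLaplacian F) x y‖ₑ * ENNReal.ofReal (T.m x) else 0 := by
        refine ENNReal.tsum_le_tsum fun p => ?_
        have hm := T.m_pos (T.pred^[p.2] y)
        have h1 : (‖wordCoeff F (p.1 + p.2)‖ - 2 * M / q) * (1 - 1 / q)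
            = (‖wordCoeff F (p.1 + p.2)‖ - 2 * M / q) / T.m (T.pred^[p.2] y)
              * (T.m (T.pred^[p.2] y) * (1 - 1 / q)) := by
          field_simp
        have h2 : 0 ≤ T.m (T.pred^[p.2] y) * (1 - 1 / (q : ℝ)) := by
          refine mul_nonneg hm.le (sub_nonneg.mpr ?_)
          rw [div_le_one (by linarith)]
          exact hq
        rw [h1, ENNReal.ofReal_mul' h2]
        refine (mul_le_mul_right (mul_le_mul_right
          (hT.le_measure_isConfluent y p.1 p.2) _) _).trans ?_
        rw [measure_apply, ← mul_assoc, ← ENNReal.tsum_mul_left]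
        refine ENNReal.tsum_le_tsum fun x => ?_
        by_cases h : T.IsConfluent x y p.1 p.2
        · rw [if_pos h, Set.indicator_of_mem (show x ∈ {x | T.IsConfluent x y p.1 p.2} from h)]
          have h3 := T.level_eq_of_pred_iterate_eq h.1
          rw [show T.level x = T.level y + p.2 - p.1 by omega]
          gcongr
          · exact hw _ _ h.le_dist
          · exact hT.le_enorm_kernel hF hM h
        · rw [Set.indicator_of_notMem (show x ∉ {x | T.IsConfluent x y p.1 p.2} from h), mul_zero]
          exact zero_le
    _ = _ := by
        rw [ENNReal.tsum_comm]
        refine tsum_congr fun x => ?_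
        obtain ⟨a, b, h⟩ := T.exists_isConfluent x y
        rw [tsum_eq_single (a, b), if_pos h]
        rintro ⟨a', b'⟩ hne
        refine if_neg fun h' => hne ?_
        obtain ⟨rfl, rfl⟩ := h.unique h'
        rfl

end IsCanonicalHomogeneous

theorem weightedKernelNorm_le_liminf (T : FlowTree) (𝕋 : ℕ+ → FlowTree)
    (h𝕋 : ∀ q : ℕ+, (𝕋 q).IsCanonicalHomogeneous q) {F : ℝ → ℂ} (hF : Continuous F)
    {w : ℕ → ℤ → ℤ → ℝ≥0} (hw : ∀ k l : ℤ, Monotone fun n : ℕ => w n k l) :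
    T.weightedKernelNorm w (T.functionOfLaplacian F) ≤
      liminf (fun q : ℕ+ => (𝕋 q).weightedKernelNorm w ((𝕋 q).functionOfLaplacian F)) atTop := by
  obtain ⟨M, hM⟩ := exists_norm_le_of_continuous hF
  refine iSup_le fun y => (tsum_weight_mul_kernel_le hF hw y).trans ?_
  -- The errors in 1/q vanish term by term, so finitely many pairs are treated at a time.
  rw [ENNReal.tsum_eq_iSup_sum]
  refine iSup_le fun s => ?_
  have hlim : Tendsto (fun q : ℕ+ => ∑ p ∈ s,
      (w (p.1 + p.2) (T.level y + p.2 - p.1) (T.level y) : ℝ≥0∞) *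
        ENNReal.ofReal ((‖wordCoeff F (p.1 + p.2)‖ - 2 * M / q) * (1 - 1 / q))) atTop
      (𝓝 (∑ p ∈ s, (w (p.1 + p.2) (T.level y + p.2 - p.1) (T.level y) : ℝ≥0∞) *
        ‖wordCoeff F (p.1 + p.2)‖ₑ)) := by
    refine tendsto_finsetSum s fun p _ => ?_
    refine ENNReal.Tendsto.const_mul ?_ (Or.inr ENNReal.coe_ne_top)
    rw [← ofReal_norm]
    refine ENNReal.tendsto_ofReal ?_
    have h1 := ((tendsto_one_div_pnat (2 * M)).const_sub ‖wordCoeff F (p.1 + p.2)‖).mul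
      ((tendsto_one_div_pnat 1).const_sub 1)
    simpa using h1
  rw [← hlim.liminf_eq]
  refine liminf_le_liminf (Eventually.of_forall fun q => ?_)
  -- The weight depends on the level of y, so the comparison vertex must have the same level.
  obtain ⟨y', hy'⟩ := (h𝕋 q).exists_level_eq (T.level y)
  rw [← hy']
  refine (ENNReal.sum_le_tsum s).trans ?_
  exact ((h𝕋 q).le_tsum_weight_mul_kernel hF hM hw y').trans
    (le_iSup (fun y => ∑' x : (𝕋 q).V,
      (w ((𝕋 q).graph.dist x y) ((𝕋 q).level x) ((𝕋 q).level y) : ℝ≥0∞) *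
        ‖(𝕋 q).kernel ((𝕋 q).functionOfLaplacian F) x y‖ₑ * ENNReal.ofReal ((𝕋 q).m x)) y')

end FlowTree

/-! ### Countability, and `L^p` norms tested on finite sets. -/

namespace InftyRootedTree

variable (T : InftyRootedTree)

theorem finite_preimage_pred_iterate (n : ℕ) (z : T.V) : (T.pred^[n] ⁻¹' {z}).Finite := by
  induction n generalizing z with
  | zero => simp
  | succ n ih =>
    have h : T.pred^[n + 1] ⁻¹' {z} ⊆ ⋃ y ∈ T.succ z, T.pred^[n] ⁻¹' {y} := by
      intro x hx
      simp only [Set.mem_iUnion]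
      refine ⟨T.pred^[n] x, ?_, rfl⟩
      rw [Set.mem_preimage, Function.iterate_succ_apply'] at hx
      exact hx
    exact ((T.finite_succ z).biUnion fun y _ => ih y).subset h

instance countable : Countable T.V := by
  obtain ⟨x⟩ := T.isTree.connected.nonempty
  rw [← Set.countable_univ_iff]
  have h : Set.univ ⊆ ⋃ a : ℕ, ⋃ b : ℕ, T.pred^[b] ⁻¹' {T.pred^[a] x} := by
    intro y _
    obtain ⟨a, b, hab, -⟩ := T.exists_common_ancestor x y
    simp only [Set.mem_iUnion]
    exact ⟨a, b, hab.symm⟩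
  exact (Set.countable_iUnion fun a => Set.countable_iUnion fun b =>
    (T.finite_preimage_pred_iterate b _).countable).mono h

end InftyRootedTree

namespace FlowTree

variable (T : FlowTree)

theorem lintegral_measure (g : T.V → ℝ≥0∞) :
    ∫⁻ x, g x ∂T.measure = ∑' x, ENNReal.ofReal (T.m x) * g x := by
  rw [measure, lintegral_withDensity_eq_lintegral_mul _ Measurable.of_discrete
    Measurable.of_discrete, lintegral_count]
  rfl

theorem enorm_le_eLpNorm_top (u : T.V → ℂ) (x : T.V) : ‖u x‖ₑ ≤ eLpNorm u ∞ T.measure := by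
  rw [eLpNorm_exponent_top]
  exact T.ae_measure_iff.mp (enorm_ae_le_eLpNormEssSup u T.measure) x

theorem eLpNorm_top_le {u : T.V → ℂ} {B : ℝ≥0∞} (h : ∀ x, ‖u x‖ₑ ≤ B) :
    eLpNorm u ∞ T.measure ≤ B := by
  rw [eLpNorm_exponent_top]
  exact eLpNormEssSup_le_of_ae_enorm_bound (Eventually.of_forall h)

theorem eLpNorm_indicator_finset (u : T.V → ℂ) (D : Finset T.V) {p : ℝ≥0∞} (hp0 : p ≠ 0)
    (hp : p ≠ ∞) :
    eLpNorm ((D : Set T.V).indicator u) p T.measure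
      = (∑ y ∈ D, ENNReal.ofReal (T.m y) * ‖u y‖ₑ ^ p.toReal) ^ (1 / p.toReal) := by
  rw [eLpNorm_eq_lintegral_rpow_enorm_toReal hp0 hp, lintegral_measure, tsum_eq_sum (s := D)]
  · congr 1
    refine Finset.sum_congr rfl fun y hy => ?_
    rw [Set.indicator_of_mem (Finset.mem_coe.mpr hy)]
  · intro y hy
    rw [Set.indicator_of_notMem (Finset.mem_coe.not.mpr hy), enorm_zero,
      ENNReal.zero_rpow_of_pos (ENNReal.toReal_pos hp0 hp), mul_zero]

theorem eLpNorm_le_of_forall_finset {u : T.V → ℂ} {p B : ℝ≥0∞} (hp0 : p ≠ 0)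
    (h : ∀ E : Finset T.V, eLpNorm ((E : Set T.V).indicator u) p T.measure ≤ B) :
    eLpNorm u p T.measure ≤ B := by
  by_cases hp : p = ∞
  · subst hp
    refine T.eLpNorm_top_le fun x => ?_
    refine le_trans ?_ ((T.enorm_le_eLpNorm_top _ x).trans (h {x}))
    simp
  · have hpos := ENNReal.toReal_pos hp0 hp
    rw [eLpNorm_eq_lintegral_rpow_enorm_toReal hp0 hp, one_div, ENNReal.rpow_inv_le_iff hpos,
      lintegral_measure, ENNReal.tsum_eq_iSup_sum]
    refine iSup_le fun E => ?_
    have hE := h E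
    rwa [eLpNorm_indicator_finset T u E hp0 hp, one_div, ENNReal.rpow_inv_le_iff hpos] at hE

/-- This also covers p = ∞: there `1 / p.toReal` is 1/0 = 0, so the mass factor is 1. -/
theorem eLpNorm_indicator_singleton (u : T.V → ℂ) (x : T.V) {p : ℝ≥0∞} (hp0 : p ≠ 0) :
    eLpNorm (({x} : Set T.V).indicator u) p T.measure
      = ‖u x‖ₑ * T.measure {x} ^ (1 / p.toReal) := by
  have h : ({x} : Set T.V).indicator u = ({x} : Set T.V).indicator fun _ => u x := by
    refine Set.indicator_congr fun y hy => ?_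
    rw [Set.mem_singleton_iff.mp hy]
  rw [h, eLpNorm_indicator_const' (MeasurableSet.of_discrete) _ hp0]
  rw [measure_singleton]
  simpa using T.m_pos x

theorem eLpNorm_indicator_finset_le (u : T.V → ℂ) (E : Finset T.V) {p : ℝ≥0∞} (hp : 1 ≤ p) :
    eLpNorm ((E : Set T.V).indicator u) p T.measure
      ≤ ∑ x ∈ E, ‖u x‖ₑ * T.measure {x} ^ (1 / p.toReal) := by
  classical
  have h : (E : Set T.V).indicator u = ∑ x ∈ E, ({x} : Set T.V).indicator u := by
    ext y
    rw [Finset.sum_apply]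
    simp [Set.indicator_apply]
  rw [h]
  refine (eLpNorm_sum_le (fun _ _ => .of_discrete) hp).trans ?_
  refine Finset.sum_le_sum fun x _ => ?_
  rw [T.eLpNorm_indicator_singleton u x (zero_lt_one.trans_le hp).ne']

theorem exists_norm_le_one_mul_eq_norm (z : ℂ) : ∃ u : ℂ, ‖u‖ ≤ 1 ∧ u * z = ‖z‖ := by
  rcases eq_or_ne z 0 with rfl | hz
  · exact ⟨0, by simp, by simp⟩
  · have h : (‖z‖ : ℂ) ≠ 0 := by exact_mod_cast norm_ne_zero_iff.mpr hz
    refine ⟨starRingEnd ℂ z / ‖z‖, ?_, ?_⟩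
    · rw [norm_div, RCLike.norm_conj, Complex.norm_real, norm_norm,
        div_self (norm_ne_zero_iff.mpr hz)]
    · rw [div_mul_eq_mul_div, Complex.conj_mul', sq, mul_div_assoc, div_self h, mul_one]

variable {T}

/-- Boundedness on `L^p(m)` may be tested on finitely supported functions. -/
theorem lpBound_of_finset {K : T.V → T.V → ℂ} {p C : ℝ≥0∞} (hp : 1 ≤ p) (hC : C ≠ ∞)
    (h : ∀ (D : Finset T.V) (f : T.V → ℂ), (∀ y ∉ D, f y = 0) →
      eLpNorm ((D : Set T.V).indicator fun x => ∑ y ∈ D, K x y * f y * (T.m y : ℂ)) p T.measure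
        ≤ C * eLpNorm f p T.measure) : T.LpBound K p C := by
  classical
  have hp0 : p ≠ 0 := (zero_lt_one.trans_le hp).ne'
  -- The window E of output points is freed from the support D by applying the hypothesis on D ∪ E.
  have h' : ∀ (D E : Finset T.V) (f : T.V → ℂ), (∀ y ∉ D, f y = 0) →
      eLpNorm ((E : Set T.V).indicator fun x => ∑ y ∈ D, K x y * f y * (T.m y : ℂ)) p T.measure
        ≤ C * eLpNorm f p T.measure := by
    intro D E f hf
    refine le_trans (eLpNorm_mono_enorm fun x => ?_)
      (h (D ∪ E) f fun y hy => hf y fun hy' => hy (Finset.mem_union_left _ hy'))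
    have hsum : ∑ y ∈ D ∪ E, K x y * f y * (T.m y : ℂ) = ∑ y ∈ D, K x y * f y * (T.m y : ℂ) :=
      (Finset.sum_subset Finset.subset_union_left fun y _ hy => by simp [hf y hy]).symm
    by_cases hx : x ∈ E
    · rw [Set.indicator_of_mem (Finset.mem_coe.mpr hx), Set.indicator_of_mem (by simp [hx]), hsum]
    · rw [Set.indicator_of_notMem (Finset.mem_coe.not.mpr hx), enorm_zero]
      exact zero_le
  intro f hf
  have hpos : ∀ x, T.measure {x} ^ (1 / p.toReal) ≠ 0 := fun x => by
    rw [ne_eq, ENNReal.rpow_eq_zero_iff, measure_singleton]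
    simp [T.m_pos x]
  have htop : ∀ x, T.measure {x} ^ (1 / p.toReal) ≠ ∞ := fun x =>
    ENNReal.rpow_ne_top_of_nonneg (by positivity) (T.measure_singleton_ne_top x)
  have hsum : ∀ x, Summable fun y => K x y * f y * (T.m y : ℂ) := by
    intro x
    refine Summable.of_norm (summable_of_sum_le
      (c := (C * eLpNorm f p T.measure / T.measure {x} ^ (1 / p.toReal)).toReal)
      (fun _ => norm_nonneg _) fun D => ?_)
    -- Multiplying f by suitable phases makes every term at x nonnegative, so the bound at the
    -- single point x controls the sum of absolute values.
    choose θ hθ1 hθ using fun y => exists_norm_le_one_mul_eq_norm (K x y * f y * (T.m y : ℂ))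
    set g : T.V → ℂ := (D : Set T.V).indicator fun y => θ y * f y with hg
    have hgf : eLpNorm g p T.measure ≤ eLpNorm f p T.measure := by
      refine eLpNorm_mono fun y => ?_
      refine (norm_indicator_le_norm_self _ _).trans ?_
      rw [norm_mul]
      exact mul_le_of_le_one_left (norm_nonneg _) (hθ1 y)
    have h1 := (h' D {x} g fun y hy => Set.indicator_of_notMem (by simpa using hy) _).trans
      (mul_le_mul_right hgf C)
    rw [Finset.coe_singleton, T.eLpNorm_indicator_singleton _ _ hp0] at h1
    have h2 : ∑ y ∈ D, K x y * g y * (T.m y : ℂ)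
        = ((∑ y ∈ D, ‖K x y * f y * (T.m y : ℂ)‖ : ℝ) : ℂ) := by
      rw [Complex.ofReal_sum]
      refine Finset.sum_congr rfl fun y hy => ?_
      rw [hg, Set.indicator_of_mem (Finset.mem_coe.mpr hy), ← hθ y]
      ring
    rw [h2, ← ENNReal.le_div_iff_mul_le (Or.inl (hpos x)) (Or.inl (htop x)), ← ofReal_norm,
      Complex.norm_real, Real.norm_of_nonneg (Finset.sum_nonneg fun _ _ => norm_nonneg _)] at h1
    exact (ENNReal.ofReal_le_iff_le_toReal (ENNReal.div_ne_top
      (ENNReal.mul_ne_top hC hf.2.ne) (hpos x))).mp h1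
  refine ⟨hsum, T.eLpNorm_le_of_forall_finset hp0 fun E => ?_⟩
  have hlim : Tendsto (fun D : Finset T.V => C * eLpNorm f p T.measure + ∑ x ∈ E,
      ‖(∑' y, K x y * f y * (T.m y : ℂ)) - ∑ y ∈ D, K x y * f y * (T.m y : ℂ)‖ₑ
        * T.measure {x} ^ (1 / p.toReal)) atTop (𝓝 (C * eLpNorm f p T.measure)) := by
    have h1 : Tendsto (fun D : Finset T.V => ∑ x ∈ E,
      ‖(∑' y, K x y * f y * (T.m y : ℂ)) - ∑ y ∈ D, K x y * f y * (T.m y : ℂ)‖ₑ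
        * T.measure {x} ^ (1 / p.toReal)) atTop (𝓝 (∑ x ∈ E, 0)) := by
      refine tendsto_finsetSum E fun x _ => ?_
      have h2 := (((hsum x).hasSum.const_sub (∑' y, K x y * f y * (T.m y : ℂ))).enorm)
      rw [sub_self, enorm_zero] at h2
      simpa using ENNReal.Tendsto.mul_const h2 (Or.inr (htop x))
    simpa using h1.const_add (C * eLpNorm f p T.measure)
  refine ge_of_tendsto hlim (Eventually.of_forall fun D => ?_)
  set u : T.V → ℂ := fun x => ∑' y, K x y * f y * (T.m y : ℂ) with hu
  set v : T.V → ℂ := fun x => ∑ y ∈ D, K x y * f y * (T.m y : ℂ) with hv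
  have huv : (E : Set T.V).indicator u
      = (E : Set T.V).indicator v + (E : Set T.V).indicator (u - v) := by
    rw [← Set.indicator_add', add_sub_cancel]
  rw [huv]
  refine (eLpNorm_add_le .of_discrete .of_discrete hp).trans ?_
  refine add_le_add ?_ (T.eLpNorm_indicator_finset_le _ _ hp)
  have h1 := h' D E ((D : Set T.V).indicator f)
    fun y hy => Set.indicator_of_notMem (by simpa using hy) _
  have h2 : (fun x => ∑ y ∈ D, K x y * (D : Set T.V).indicator f y * (T.m y : ℂ)) = v := by
    ext x
    refine Finset.sum_congr rfl fun y hy => ?_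
    rw [Set.indicator_of_mem (Finset.mem_coe.mpr hy)]
  rw [h2] at h1
  exact h1.trans (mul_le_mul_right (eLpNorm_indicator_le _) _)

/-! ### Pulling back functions along a finite family of fibres -/

variable {S : FlowTree}

open Classical in
/-- The function on `S` that is equal to `u y` on the fibre `A y`, for `y ∈ D`, and vanishes
outside these fibres. -/
noncomputable def pullback (D : Finset T.V) (A : T.V → Finset S.V) (u : T.V → ℂ) (t : S.V) : ℂ :=
  ∑ y ∈ D, if t ∈ A y then u y else 0

variable {D : Finset T.V} {A : T.V → Finset S.V}

theorem pullback_of_mem (hA : (D : Set T.V).PairwiseDisjoint A) (u : T.V → ℂ) {t : S.V} {y : T.V}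
    (hy : y ∈ D) (ht : t ∈ A y) : pullback D A u t = u y := by
  rw [pullback, Finset.sum_eq_single_of_mem y hy, if_pos ht]
  intro y' hy' hne
  refine if_neg fun ht' => ?_
  exact (Finset.disjoint_left.mp (hA hy' hy hne)) ht' ht

theorem pullback_of_notMem (u : T.V → ℂ) {t : S.V} (h : ∀ y ∈ D, t ∉ A y) :
    pullback D A u t = 0 :=
  Finset.sum_eq_zero fun y hy => if_neg (h y hy)

theorem eLpNorm_pullback (hA : (D : Set T.V).PairwiseDisjoint A) (u : T.V → ℂ) {p : ℝ≥0∞}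
    (hp0 : p ≠ 0) (hp : p ≠ ∞) :
    eLpNorm (pullback D A u) p S.measure
      = (∑ y ∈ D, ENNReal.ofReal (∑ t ∈ A y, S.m t) * ‖u y‖ₑ ^ p.toReal) ^ (1 / p.toReal) := by
  classical
  have hpos := ENNReal.toReal_pos hp0 hp
  rw [eLpNorm_eq_lintegral_rpow_enorm_toReal hp0 hp, lintegral_measure,
    tsum_eq_sum (s := D.biUnion A), Finset.sum_biUnion hA]
  · congr 1
    refine Finset.sum_congr rfl fun y hy => ?_
    rw [ENNReal.ofReal_sum_of_nonneg fun t _ => (S.m_pos t).le, Finset.sum_mul]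
    refine Finset.sum_congr rfl fun t ht => ?_
    rw [pullback_of_mem hA u hy ht]
  · intro t ht
    rw [pullback_of_notMem, enorm_zero, ENNReal.zero_rpow_of_pos hpos, mul_zero]
    intro y hy hty
    exact ht (Finset.mem_biUnion.mpr ⟨y, hy, hty⟩)

theorem eLpNorm_pullback_le (hA : (D : Set T.V).PairwiseDisjoint A) (u : T.V → ℂ) {p : ℝ≥0∞}
    (hp0 : p ≠ 0) {c : ℝ} (hc : 0 ≤ c) (hM : ∀ y ∈ D, ∑ t ∈ A y, S.m t ≤ c * T.m y) :
    eLpNorm (pullback D A u) p S.measure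
      ≤ ENNReal.ofReal c ^ (1 / p.toReal)
        * eLpNorm ((D : Set T.V).indicator u) p T.measure := by
  by_cases hp : p = ∞
  · subst hp
    rw [ENNReal.toReal_top, div_zero, ENNReal.rpow_zero, one_mul]
    refine S.eLpNorm_top_le fun t => ?_
    by_cases h : ∃ y ∈ D, t ∈ A y
    · obtain ⟨y, hy, ht⟩ := h
      rw [pullback_of_mem hA u hy ht]
      have h1 := T.enorm_le_eLpNorm_top ((D : Set T.V).indicator u) y
      rwa [Set.indicator_of_mem (Finset.mem_coe.mpr hy)] at h1
    · push Not at h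
      rw [pullback_of_notMem u h, enorm_zero]
      exact zero_le
  · rw [eLpNorm_pullback hA u hp0 hp, T.eLpNorm_indicator_finset u D hp0 hp,
      ← ENNReal.mul_rpow_of_nonneg _ _ (by positivity)]
    refine ENNReal.rpow_le_rpow ?_ (by positivity)
    rw [Finset.mul_sum]
    refine Finset.sum_le_sum fun y hy => ?_
    rw [← mul_assoc, ← ENNReal.ofReal_mul hc]
    gcongr
    exact hM y hy

/-- For finite p fibre masses are compared. For p = ∞ only nonempty fibres are needed, which the
positive lower bound on their mass provides. -/
theorem le_eLpNorm_pullback (hA : (D : Set T.V).PairwiseDisjoint A) (u : T.V → ℂ) {p : ℝ≥0∞}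
    (hp0 : p ≠ 0) {c : ℝ} (hc : 0 < c) (hM : ∀ y ∈ D, c * T.m y ≤ ∑ t ∈ A y, S.m t) :
    ENNReal.ofReal c ^ (1 / p.toReal) * eLpNorm ((D : Set T.V).indicator u) p T.measure
      ≤ eLpNorm (pullback D A u) p S.measure := by
  by_cases hp : p = ∞
  · subst hp
    rw [ENNReal.toReal_top, div_zero, ENNReal.rpow_zero, one_mul]
    refine T.eLpNorm_top_le fun y => ?_
    by_cases hy : y ∈ D
    · obtain ⟨t, ht⟩ : (A y).Nonempty := by
        rw [Finset.nonempty_iff_ne_empty]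
        intro h
        have h1 := hM y hy
        rw [h, Finset.sum_empty] at h1
        exact absurd h1 (not_le.mpr (mul_pos hc (T.m_pos y)))
      rw [Set.indicator_of_mem (Finset.mem_coe.mpr hy), ← pullback_of_mem hA u hy ht]
      exact S.enorm_le_eLpNorm_top _ t
    · rw [Set.indicator_of_notMem (Finset.mem_coe.not.mpr hy), enorm_zero]
      exact zero_le
  · rw [eLpNorm_pullback hA u hp0 hp, T.eLpNorm_indicator_finset u D hp0 hp,
      ← ENNReal.mul_rpow_of_nonneg _ _ (by positivity)]
    refine ENNReal.rpow_le_rpow ?_ (by positivity)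
    rw [Finset.mul_sum]
    refine Finset.sum_le_sum fun y hy => ?_
    rw [← mul_assoc, ← ENNReal.ofReal_mul hc.le]
    gcongr
    exact hM y hy

end FlowTree

/-! ### Labelling a homogeneous tree by the vertices of T. -/

theorem Finset.exists_pairwiseDisjoint_card_eq {α β : Type*} (Y : Finset α) (n : α → ℕ)
    (U : Finset β) (h : ∑ y ∈ Y, n y ≤ U.card) :
    ∃ c : α → Finset β, (∀ y ∈ Y, c y ⊆ U ∧ (c y).card = n y) ∧
      (Y : Set α).PairwiseDisjoint c := by
  classical
  induction Y using Finset.induction_on with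
  | empty => exact ⟨fun _ => ∅, by simp, by simp⟩
  | insert y Y hy ih =>
    rw [Finset.sum_insert hy] at h
    obtain ⟨c, hc, hdisj⟩ := ih (by omega)
    have h1 : (Y.biUnion c).card ≤ ∑ y ∈ Y, n y :=
      Finset.card_biUnion_le.trans (Finset.sum_le_sum fun z hz => (hc z hz).2.le)
    have h2 : n y ≤ (U \ Y.biUnion c).card := by
      have := Finset.le_card_sdiff (Y.biUnion c) U
      omega
    obtain ⟨B, hB, hcard⟩ := Finset.exists_subset_card_eq h2
    have hne : ∀ z ∈ Y, z ≠ y := fun z hz hzy => hy (hzy ▸ hz)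
    have hupd : ∀ z ∈ Y, Function.update c y B z = c z := fun z hz =>
      Function.update_of_ne (hne z hz) _ _
    refine ⟨Function.update c y B, ?_, ?_⟩
    · intro z hz
      rcases Finset.mem_insert.mp hz with rfl | hz
      · rw [Function.update_self]
        exact ⟨hB.trans Finset.sdiff_subset, hcard⟩
      · rw [hupd z hz]
        exact hc z hz
    · rw [Finset.coe_insert, Set.pairwiseDisjoint_insert]
      refine ⟨?_, ?_⟩
      · intro z hz z' hz' hzz'
        rw [Function.onFun, hupd z hz, hupd z' hz']
        exact hdisj hz hz' hzz'
      · intro z hz _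
        rw [Function.update_self, hupd z hz]
        rw [Finset.disjoint_left]
        intro t ht ht'
        exact (Finset.mem_sdiff.mp (hB ht)).2 (Finset.mem_biUnion.mpr ⟨z, hz, ht'⟩)

/-- A partial labelling of the successors of the vertices of `S` by vertices of `T`: for a vertex
`s` of `S` with the label `𝔭 (y)`, the successors of `s` with the label `y` form the set
`child s y`, which has `mult y` elements. -/
structure Branching (S T : InftyRootedTree) where
  child : S.V → T.V → Finset S.V
  mult : T.V → ℕ
  pred_eq : ∀ {s y t}, t ∈ child s y → S.pred t = s
  eq_of_mem : ∀ {s y y' t}, t ∈ child s y → t ∈ child s y' → T.pred y = T.pred y' → y = y'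
  card_child : ∀ s y, (child s y).card = mult y

namespace Branching

section

variable {S T : InftyRootedTree} (β : Branching S T)

open Classical in
/-- The descendants with label `y`, at depth `b` below a vertex `s` with label `𝔭 ^ b (y)`. -/
noncomputable def fiber : ℕ → S.V → T.V → Finset S.V
  | 0, s, _ => {s}
  | b + 1, s, y => (fiber b s (T.pred y)).biUnion fun t => β.child t y

open Classical in
theorem mem_fiber_succ {b : ℕ} {s t : S.V} {y : T.V} :
    t ∈ β.fiber (b + 1) s y ↔ S.pred t ∈ β.fiber b s (T.pred y) ∧ t ∈ β.child (S.pred t) y := by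
  rw [fiber, Finset.mem_biUnion]
  constructor
  · rintro ⟨u, hu, ht⟩
    rw [β.pred_eq ht]
    exact ⟨hu, ht⟩
  · rintro ⟨hu, ht⟩
    exact ⟨_, hu, ht⟩

variable {β}

theorem pred_iterate_eq_of_mem {b : ℕ} {s t : S.V} {y : T.V} (h : t ∈ β.fiber b s y) :
    S.pred^[b] t = s := by
  induction b generalizing t y with
  | zero => simpa [fiber] using h
  | succ b ih => exact ih (β.mem_fiber_succ.mp h).1

/-- Labels exist only relative to the label given to s. Once that is fixed they are unique, by
descending one generation at a time. -/
theorem eq_of_mem_fiber {b : ℕ} {s t : S.V} {y y' : T.V} (h : t ∈ β.fiber b s y)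
    (h' : t ∈ β.fiber b s y') (hy : T.pred^[b] y = T.pred^[b] y') : y = y' := by
  induction b generalizing t y y' with
  | zero => simpa using hy
  | succ b ih =>
    rw [mem_fiber_succ] at h h'
    exact β.eq_of_mem h.2 h'.2 (ih h.1 h'.1 hy)

theorem mem_fiber_add {k b : ℕ} {s t : S.V} {y : T.V} :
    t ∈ β.fiber (k + b) s y ↔
      S.pred^[b] t ∈ β.fiber k s (T.pred^[b] y) ∧ t ∈ β.fiber b (S.pred^[b] t) y := by
  induction b generalizing t y with
  | zero => simp [fiber]
  | succ b ih =>
    rw [← add_assoc, mem_fiber_succ, ih, mem_fiber_succ, Function.iterate_succ_apply,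
      Function.iterate_succ_apply, and_assoc]

open Classical in
-- Self-similarity: the part of a fibre lying below an intermediate vertex with the right label is
-- the fibre started at that vertex.
theorem filter_fiber_add {k b : ℕ} {s u : S.V} {y : T.V} (hu : u ∈ β.fiber k s (T.pred^[b] y)) :
    {t ∈ β.fiber (k + b) s y | S.pred^[b] t = u} = β.fiber b u y := by
  ext t
  rw [Finset.mem_filter, mem_fiber_add]
  constructor
  · rintro ⟨⟨-, h⟩, rfl⟩
    exact h
  · intro h
    have h1 := pred_iterate_eq_of_mem h
    rw [h1]
    exact ⟨⟨hu, h⟩, rfl⟩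

end

section

variable {S T : FlowTree} (β : Branching S.toInftyRootedTree T.toInftyRootedTree)

/-- The proportion of the descendants with label `y` at depth `b` in a tree of degree `q + 1`. -/
noncomputable def ratio (q : ℕ+) (b : ℕ) (y : T.V) : ℝ :=
  ∏ i ∈ Finset.range b, (β.mult (T.pred^[i] y) / q : ℝ)

variable {β}

open Classical in
theorem sum_m_fiber {q : ℕ+} (hS : S.IsCanonicalHomogeneous q) (b : ℕ) (s : S.V) (y : T.V) :
    ∑ t ∈ β.fiber b s y, S.m t = β.ratio q b y * S.m s := by
  have hq : (q : ℝ) ≠ 0 := by exact_mod_cast q.ne_zero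
  induction b generalizing y with
  | zero => simp [fiber, ratio]
  | succ b ih =>
    rw [fiber, Finset.sum_biUnion]
    · have h1 : ∀ t ∈ β.fiber b s (T.pred y), ∑ u ∈ β.child t y, S.m u
          = β.mult y / q * S.m t := by
        intro t _
        have h2 : ∀ u ∈ β.child t y, S.m u = S.m t / q := by
          intro u hu
          have h3 := hS.m_pred u
          rw [β.pred_eq hu] at h3
          rw [h3]
          field_simp
        rw [Finset.sum_congr rfl h2, Finset.sum_const, β.card_child, nsmul_eq_mul]
        ring
      rw [Finset.sum_congr rfl h1, ← Finset.mul_sum, ih, ratio, ratio, Finset.prod_range_succ']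
      simp only [Function.iterate_succ_apply, Function.iterate_zero_apply]
      ring
    · intro t _ t' _ hne
      rw [Function.onFun, Finset.disjoint_left]
      intro u hu hu'
      exact hne ((β.pred_eq hu).symm.trans (β.pred_eq hu'))

end

end Branching

namespace FlowTree

theorem sum_m_succ (T : FlowTree) (x : T.V) :
    ∑ y ∈ (T.finite_succ x).toFinset, T.m y = T.m x := by
  rw [T.m_flow x, finsum_mem_eq_finite_toFinset_sum]

/-- The canonical homogeneous tree of degree `q + 1` has a labelling by the vertices of `T`, in
which the labels are nearly distributed as the flow measure of `T`. -/
theorem IsCanonicalHomogeneous.exists_branching {S : FlowTree} {q : ℕ+}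
    (hS : S.IsCanonicalHomogeneous q) (T : FlowTree) :
    ∃ β : Branching S.toInftyRootedTree T.toInftyRootedTree,
      ∀ y, β.mult y = ⌊q * (T.m y / T.m (T.pred y))⌋₊ := by
  set n : T.V → ℕ := fun y => ⌊q * (T.m y / T.m (T.pred y))⌋₊ with hn
  have hex : ∀ (s : S.V) (x : T.V), ∃ c : T.V → Finset S.V,
      (∀ y ∈ (T.finite_succ x).toFinset, c y ⊆ (S.finite_succ s).toFinset ∧ (c y).card = n y) ∧
      ((T.finite_succ x).toFinset : Set T.V).PairwiseDisjoint c := by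
    intro s x
    refine Finset.exists_pairwiseDisjoint_card_eq _ n _ ?_
    rw [← Set.ncard_eq_toFinset_card _ (S.finite_succ s), hS.1]
    -- There is room for all labels: the floors add up to at most q ∑ m(y)/m(x), which is q by the
    -- flow condition.
    have h1 : ∑ y ∈ (T.finite_succ x).toFinset, (n y : ℝ)
        ≤ ∑ y ∈ (T.finite_succ x).toFinset, q * (T.m y / T.m x) := by
      refine Finset.sum_le_sum fun y hy => ?_
      have hy' : T.pred y = x := (T.finite_succ x).mem_toFinset.mp hy
      have h2 : (0 : ℝ) ≤ q * (T.m y / T.m (T.pred y)) := by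
        have := T.m_pos y
        have := T.m_pos (T.pred y)
        positivity
      have h3 := Nat.floor_le h2
      rw [← hy']
      exact h3
    rw [← Finset.mul_sum, ← Finset.sum_div, sum_m_succ, div_self (T.m_pos x).ne', mul_one] at h1
    exact_mod_cast h1
  choose c hc hdisj using hex
  have hmem : ∀ y : T.V, y ∈ (T.finite_succ (T.pred y)).toFinset := fun y =>
    (T.finite_succ (T.pred y)).mem_toFinset.mpr rfl
  refine ⟨⟨fun s y => c s (T.pred y) y, n, ?_, ?_, ?_⟩, fun y => rfl⟩
  · intro s y t ht
    exact (S.finite_succ s).mem_toFinset.mp ((hc s (T.pred y) y (hmem y)).1 ht)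
  · intro s y y' t ht ht' hyy'
    by_contra hne
    have h1 := hdisj s (T.pred y) (hmem y) (by rw [hyy']; exact hmem y') hne
    rw [← hyy'] at ht'
    exact Finset.disjoint_left.mp h1 ht ht'
  · intro s y
    exact (hc s (T.pred y) y (hmem y)).2

end FlowTree

namespace InftyRootedTree

theorem exists_common_ancestor_finset (T : InftyRootedTree) (D : Finset T.V) :
    ∃ (z : T.V) (dep : T.V → ℕ), ∀ y ∈ D, T.pred^[dep y] y = z := by
  classical
  induction D using Finset.induction_on with
  | empty =>
    obtain ⟨x⟩ := T.isTree.connected.nonempty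
    exact ⟨x, fun _ => 0, by simp⟩
  | insert x D hx ih =>
    obtain ⟨z, dep, h⟩ := ih
    obtain ⟨a, b, hab, -⟩ := T.exists_common_ancestor x z
    refine ⟨T.pred^[b] z, fun y => if y = x then a else b + dep y, fun y hy => ?_⟩
    dsimp only
    by_cases hyx : y = x
    · rw [if_pos hyx, hyx, hab]
    · rw [if_neg hyx, Function.iterate_add_apply, h y (Finset.mem_of_mem_insert_of_ne hy hyx)]

end InftyRootedTree

/-! ### Transfer of the truncated kernel from 𝕋_q to T. -/

namespace FlowTree

variable {T : FlowTree}

open Classical in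
/-- The part of the expansion of the kernel of `F (𝓛)` at `(x, y)` given by the words
`Σ ^ a (Σ*) ^ b` with `a < A` and `b < B`. -/
noncomputable def truncKernel (T : FlowTree) (F : ℝ → ℂ) (x y : T.V) (A B : ℕ) : ℂ :=
  ∑ a ∈ Finset.range A, ∑ b ∈ Finset.range B,
    if T.pred^[a] x = T.pred^[b] y
      then wordCoeff F (a + b) * ((1 / T.m (T.pred^[b] y) : ℝ) : ℂ) else 0

/-- The rectangular window does not mention the confluent, so it can be summed over a whole fibre,
along which the confluent with a fixed vertex varies. -/
theorem kernelSum_eq_truncKernel (F : ℝ → ℂ) {x y : T.V} {a b : ℕ}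
    (h : T.IsConfluent x y a b) (J : ℕ) :
    T.kernelSum F (T.pred^[a] x) (a + b) J = T.truncKernel F x y (a + J) (b + J) := by
  rw [truncKernel, ← Finset.sum_product']
  refine Finset.sum_of_injOn (fun k => (a + k, b + k)) ?_ ?_ ?_ ?_
  · intro k _ k' _ hk
    simpa using congrArg Prod.fst hk
  · intro k hk
    have := Finset.mem_range.mp (Finset.mem_coe.mp hk)
    exact Finset.mem_coe.mpr (Finset.mem_product.mpr
      ⟨Finset.mem_range.mpr (by dsimp only; omega), Finset.mem_range.mpr (by dsimp only; omega)⟩)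
  · rintro ⟨a', b'⟩ hmem himg
    refine if_neg fun h' => himg ?_
    obtain ⟨k, hk1, hk2⟩ := h.2 _ _ h'
    have := Finset.mem_range.mp (Finset.mem_product.mp hmem).1
    dsimp only at hk1 hk2 this
    exact ⟨k, Finset.mem_coe.mpr (Finset.mem_range.mpr (by omega)), by rw [hk1, hk2]⟩
  · intro k _
    have h1 := InftyRootedTree.pred_iterate_add_eq h.1 k
    rw [if_pos h1, ← h1, add_comm a k, Function.iterate_add_apply]
    congr 2
    ring

/-- The windows A + 1 and B + 1 include the meeting at 𝔭^A x itself, so the tail begins one step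
above it, which gains a factor q on 𝕋_q. -/
theorem norm_kernel_sub_truncKernel_le {F : ℝ → ℂ} (hF : Continuous F) {M : ℝ}
    (hM : ∀ t ∈ Set.Icc (-2 : ℝ) 2, ‖F t‖ ≤ M) {x y : T.V} {A B : ℕ}
    (h : T.pred^[A] x = T.pred^[B] y) :
    ‖T.kernel (T.functionOfLaplacian F) x y - T.truncKernel F x y (A + 1) (B + 1)‖
      ≤ 2 * M / T.m (T.pred^[A + 1] x) := by
  obtain ⟨a, b, hab⟩ := T.exists_isConfluent x y
  obtain ⟨k, rfl, rfl⟩ := hab.2 _ _ h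
  rw [add_assoc, add_assoc, ← kernelSum_eq_truncKernel F hab]
  exact norm_kernel_sub_kernelSum_le hF hM hab _

theorem tendsto_truncKernel {F : ℝ → ℂ} (hF : Continuous F) {x y : T.V} {A B : ℕ}
    (h : T.pred^[A] x = T.pred^[B] y) :
    Tendsto (fun J => T.truncKernel F x y (J + A + 1) (J + B + 1)) atTop
      (𝓝 (T.kernel (T.functionOfLaplacian F) x y)) := by
  obtain ⟨a, b, hab⟩ := T.exists_isConfluent x y
  obtain ⟨k, rfl, rfl⟩ := hab.2 _ _ h
  refine ((tendsto_kernelSum hF hab).comp (tendsto_add_atTop_nat (k + 1))).congr fun J => ?_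
  rw [Function.comp_apply, kernelSum_eq_truncKernel F hab]
  congr 1 <;> ring

/-- The approximation of `m (y) / m (𝔭 ^ b (y))` realized in the tree of degree `q + 1`. -/
noncomputable def floorRatio (T : FlowTree) (q : ℕ+) (b : ℕ) (y : T.V) : ℝ :=
  ∏ i ∈ Finset.range b,
    (⌊q * (T.m (T.pred^[i] y) / T.m (T.pred (T.pred^[i] y)))⌋₊ / q : ℝ)

theorem prod_m_div (b : ℕ) (y : T.V) :
    ∏ i ∈ Finset.range b, T.m (T.pred^[i] y) / T.m (T.pred (T.pred^[i] y))
      = T.m y / T.m (T.pred^[b] y) := by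
  induction b with
  | zero => simp [(T.m_pos y).ne']
  | succ b ih =>
    rw [Finset.prod_range_succ, ih, Function.iterate_succ_apply', div_mul_div_cancel₀
      (T.m_pos _).ne']

theorem floorRatio_le (q : ℕ+) (b : ℕ) (y : T.V) :
    T.floorRatio q b y ≤ T.m y / T.m (T.pred^[b] y) := by
  have hq : (0 : ℝ) < q := by exact_mod_cast q.pos
  rw [← prod_m_div]
  refine Finset.prod_le_prod (fun _ _ => by positivity) fun i _ => ?_
  rw [div_le_iff₀ hq, mul_comm _ (q : ℝ)]
  have := T.m_pos (T.pred^[i] y)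
  have := T.m_pos (T.pred (T.pred^[i] y))
  exact Nat.floor_le (by positivity)

theorem tendsto_floorRatio (b : ℕ) (y : T.V) :
    Tendsto (fun q : ℕ+ => T.floorRatio q b y) atTop (𝓝 (T.m y / T.m (T.pred^[b] y))) := by
  rw [← prod_m_div]
  refine tendsto_finsetProd _ fun i _ => ?_
  have h := T.m_pos (T.pred^[i] y)
  have h' := T.m_pos (T.pred (T.pred^[i] y))
  have hq : Tendsto (fun q : ℕ+ => ((q : ℕ) : ℝ)) atTop atTop :=
    tendsto_natCast_atTop_atTop.comp tendsto_PNat_val_atTop_atTop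
  refine ((tendsto_nat_floor_mul_div_atTop (div_pos h h').le).comp hq).congr fun q => ?_
  rw [Function.comp_apply, mul_comm]

open Classical in
/-- The weight of the value of a function at `y` in the value at `x` of its image under `F (𝓛)`,
truncated and read on the tree of degree `q + 1`. -/
noncomputable def modelWeight (T : FlowTree) (F : ℝ → ℂ) (q : ℕ+) (x y : T.V) (A B : ℕ) : ℂ :=
  ∑ a ∈ Finset.range A, ∑ b ∈ Finset.range B,
    if T.pred^[a] x = T.pred^[b] y
      then wordCoeff F (a + b) * (T.floorRatio q b y : ℂ) else 0

theorem tendsto_modelWeight (F : ℝ → ℂ) (x y : T.V) (A B : ℕ) :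
    Tendsto (fun q : ℕ+ => T.modelWeight F q x y A B) atTop
      (𝓝 (T.truncKernel F x y A B * T.m y)) := by
  rw [truncKernel, Finset.sum_mul]
  refine tendsto_finsetSum _ fun a _ => ?_
  rw [Finset.sum_mul]
  refine tendsto_finsetSum _ fun b _ => ?_
  split_ifs with h
  · rw [mul_assoc, ← Complex.ofReal_mul, one_div_mul_eq_div]
    exact ((Complex.continuous_ofReal.tendsto _).comp (tendsto_floorRatio b y)).const_mul _
  · rw [zero_mul]
    exact tendsto_const_nhds

section Transfer

variable {S : FlowTree} {q : ℕ+} {β : Branching S.toInftyRootedTree T.toInftyRootedTree}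
  {D : Finset T.V} {dep : T.V → ℕ} {x₀ : T.V} {s₀ : S.V}

theorem level_of_mem_fiber {b : ℕ} {t : S.V} {y : T.V} (h : t ∈ β.fiber b s₀ y) :
    S.level t + b = S.level s₀ := by
  rw [← InftyRootedTree.level_pred_iterate, Branching.pred_iterate_eq_of_mem h]

/-- A vertex has one level, so two fibres containing it have the same depth, and at equal depth the
label is unique. -/
theorem pairwiseDisjoint_fiber (hdep : ∀ y ∈ D, T.pred^[dep y] y = x₀) :
    (D : Set T.V).PairwiseDisjoint fun y => β.fiber (dep y) s₀ y := by
  intro y hy y' hy' hne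
  rw [Function.onFun, Finset.disjoint_left]
  intro t ht ht'
  have h1 := level_of_mem_fiber ht
  have h2 := level_of_mem_fiber ht'
  have h3 : dep y = dep y' := by omega
  rw [← h3] at ht'
  refine hne (Branching.eq_of_mem_fiber ht ht' ?_)
  rw [hdep y hy, h3, hdep y' hy']

variable (hS : S.IsCanonicalHomogeneous q)
  (hβ : ∀ y, β.mult y = ⌊q * (T.m y / T.m (T.pred y))⌋₊)
include hS hβ

theorem sum_m_fiber (b : ℕ) (s : S.V) (y : T.V) :
    ∑ t ∈ β.fiber b s y, S.m t = T.floorRatio q b y * S.m s := by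
  rw [Branching.sum_m_fiber hS, Branching.ratio, floorRatio]
  simp only [hβ]

/-- Core of the transfer: the result depends on x' only through its label x. If 𝔭^a x = 𝔭^b y, then
u = 𝔭^a x' has the label 𝔭^b y, and the t with 𝔭^b t = u form the fibre of y below u; its mass is
`floorRatio` times m(u), and m(u) cancels. If 𝔭^a x ≠ 𝔭^b y, a meeting 𝔭^a x' = 𝔭^b t would give one
vertex two labels. -/
theorem sum_truncKernel_fiber (hdep : ∀ y ∈ D, T.pred^[dep y] y = x₀) (F : ℝ → ℂ) {x y : T.V}
    (hx : x ∈ D) (hy : y ∈ D) {x' : S.V} (hx' : x' ∈ β.fiber (dep x) s₀ x) :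
    ∑ t ∈ β.fiber (dep y) s₀ y, S.truncKernel F x' t (dep x + 1) (dep y + 1) * S.m t
      = T.modelWeight F q x y (dep x + 1) (dep y + 1) := by
  classical
  simp only [truncKernel, modelWeight, Finset.sum_mul]
  rw [Finset.sum_comm]
  refine Finset.sum_congr rfl fun a ha => ?_
  rw [Finset.sum_comm]
  refine Finset.sum_congr rfl fun b hb => ?_
  rw [Finset.mem_range] at ha hb
  have hlev : T.level x + dep x = T.level y + dep y :=
    T.level_eq_of_pred_iterate_eq ((hdep x hx).trans (hdep y hy).symm)
  have hlx := level_of_mem_fiber hx'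
  have hxa : S.pred^[a] x' ∈ β.fiber (dep x - a) s₀ (T.pred^[a] x) := by
    have h1 : dep x = dep x - a + a := by omega
    rw [h1, Branching.mem_fiber_add] at hx'
    exact hx'.1
  split_ifs with h
  · have h2 := T.level_eq_of_pred_iterate_eq h
    have h3 : dep y = dep x - a + b := by omega
    rw [h] at hxa
    have hm : (S.m (S.pred^[a] x') : ℂ) ≠ 0 := S.m_ne_zero _
    rw [h3]
    calc _ = ∑ t ∈ β.fiber (dep x - a + b) s₀ y with S.pred^[b] t = S.pred^[a] x',
          wordCoeff F (a + b) * ((1 / S.m (S.pred^[a] x') : ℝ) : ℂ) * S.m t := by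
          rw [Finset.sum_filter]
          refine Finset.sum_congr rfl fun t _ => ?_
          by_cases ht : S.pred^[b] t = S.pred^[a] x'
          · rw [if_pos ht.symm, if_pos ht, ht]
          · rw [if_neg (Ne.symm ht), if_neg ht, zero_mul]
      _ = _ := by
          rw [Branching.filter_fiber_add hxa, ← Finset.mul_sum, ← Complex.ofReal_sum,
            sum_m_fiber hS hβ]
          push_cast
          field_simp
  · refine Finset.sum_eq_zero fun t ht => ?_
    rw [if_neg, zero_mul]
    intro hab
    have hlt := level_of_mem_fiber ht
    have h2 := S.level_eq_of_pred_iterate_eq hab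
    have h3 : dep y = dep x - a + b := by omega
    have h4 := ht
    rw [h3, Branching.mem_fiber_add, ← hab] at h4
    refine h (Branching.eq_of_mem_fiber hxa h4.1 ?_)
    rw [← Function.iterate_add_apply, ← Function.iterate_add_apply, ← h3,
      show dep x - a + a = dep x by omega, hdep x hx, hdep y hy]

/-- The discarded words meet strictly above s₀, where the mass is at least q m(s₀); each kernel thus
changes by at most 2M/(q m(s₀)), and a fibre has mass at most m(s₀). -/
theorem norm_tsum_kernel_pullback_sub_le {F : ℝ → ℂ} (hF : Continuous F) {M : ℝ}
    (hM : ∀ t ∈ Set.Icc (-2 : ℝ) 2, ‖F t‖ ≤ M) (hdep : ∀ y ∈ D, T.pred^[dep y] y = x₀)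
    (f : T.V → ℂ) {x : T.V} (hx : x ∈ D) {x' : S.V} (hx' : x' ∈ β.fiber (dep x) s₀ x) :
    ‖∑' t, S.kernel (S.functionOfLaplacian F) x' t
        * pullback D (fun y => β.fiber (dep y) s₀ y) f t * (S.m t : ℂ)
      - ∑ y ∈ D, f y * T.modelWeight F q x y (dep x + 1) (dep y + 1)‖
      ≤ 2 * M / q * ∑ y ∈ D, ‖f y‖ := by
  classical
  have hA := pairwiseDisjoint_fiber (β := β) (s₀ := s₀) hdep
  have hM0 : 0 ≤ M := (norm_nonneg _).trans (hM 0 (by norm_num))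
  have hq : (0 : ℝ) < q := by exact_mod_cast q.pos
  have hs := S.m_pos s₀
  have h1 : ∑' t, S.kernel (S.functionOfLaplacian F) x' t
        * pullback D (fun y => β.fiber (dep y) s₀ y) f t * (S.m t : ℂ)
      = ∑ y ∈ D, f y * ∑ t ∈ β.fiber (dep y) s₀ y,
          S.kernel (S.functionOfLaplacian F) x' t * S.m t := by
    rw [tsum_eq_sum (s := D.biUnion fun y => β.fiber (dep y) s₀ y), Finset.sum_biUnion hA]
    · refine Finset.sum_congr rfl fun y hy => ?_
      rw [Finset.mul_sum]
      refine Finset.sum_congr rfl fun t ht => ?_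
      rw [pullback_of_mem hA f hy ht]
      ring
    · intro t ht
      rw [pullback_of_notMem, mul_zero, zero_mul]
      intro y hy hty
      exact ht (Finset.mem_biUnion.mpr ⟨y, hy, hty⟩)
  rw [h1, ← Finset.sum_sub_distrib, Finset.mul_sum]
  refine (norm_sum_le _ _).trans (Finset.sum_le_sum fun y hy => ?_)
  rw [← mul_sub, norm_mul, mul_comm]
  refine mul_le_mul_of_nonneg_right ?_ (norm_nonneg _)
  rw [← sum_truncKernel_fiber hS hβ hdep F hx hy hx', ← Finset.sum_sub_distrib]
  calc _ ≤ ∑ t ∈ β.fiber (dep y) s₀ y, 2 * M / (q * S.m s₀) * S.m t := by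
        refine (norm_sum_le _ _).trans (Finset.sum_le_sum fun t ht => ?_)
        rw [← sub_mul, norm_mul, Complex.norm_real, Real.norm_of_nonneg (S.m_pos t).le]
        refine mul_le_mul_of_nonneg_right ?_ (S.m_pos t).le
        have h2 := Branching.pred_iterate_eq_of_mem hx'
        have h3 := norm_kernel_sub_truncKernel_le hF hM
          (h2.trans (Branching.pred_iterate_eq_of_mem ht).symm)
        rwa [Function.iterate_succ_apply', h2, hS.m_pred] at h3
    _ = 2 * M / q * T.floorRatio q (dep y) y := by
        rw [← Finset.mul_sum, sum_m_fiber hS hβ]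
        field_simp
    _ ≤ 2 * M / q * 1 := by
        refine mul_le_mul_of_nonneg_left ((T.floorRatio_le q _ y).trans ?_) (by positivity)
        rw [div_le_one (T.m_pos _)]
        exact T.monotone_m_pred_iterate y (Nat.zero_le _)
    _ = _ := mul_one _

/-- Pulling back multiplies masses by c = m(s₀)/m(x₀), up to a loss 1 − η from rounding. The factor
c^{1/p} appears in every term and cancels, and only the rounding loss remains. -/
theorem eLpNorm_le_of_lpBound {F : ℝ → ℂ} {p C : ℝ≥0∞} (hp : 1 ≤ p)
    (hbound : S.LpBound (S.kernel (S.functionOfLaplacian F)) p C)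
    (hdep : ∀ y ∈ D, T.pred^[dep y] y = x₀) {f G : T.V → ℂ} (hf : ∀ y ∉ D, f y = 0)
    (s₀ : S.V) {η : ℝ} (hη0 : 0 < η) (hη1 : η < 1)
    (hratio : ∀ y ∈ D, (1 - η) * (T.m y / T.m x₀) ≤ T.floorRatio q (dep y) y)
    (hG : ∀ x ∈ D, ∀ x' ∈ β.fiber (dep x) s₀ x,
      ‖∑' t, S.kernel (S.functionOfLaplacian F) x' t
        * pullback D (fun y => β.fiber (dep y) s₀ y) f t * (S.m t : ℂ) - G x‖ ≤ η) :
    ENNReal.ofReal (1 - η) ^ (1 / p.toReal)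
        * eLpNorm ((D : Set T.V).indicator G) p T.measure
      ≤ C * eLpNorm f p T.measure
        + eLpNorm ((D : Set T.V).indicator fun _ => (η : ℂ)) p T.measure := by
  have hp0 : p ≠ 0 := (zero_lt_one.trans_le hp).ne'
  have hA := pairwiseDisjoint_fiber (β := β) (s₀ := s₀) hdep
  set A : T.V → Finset S.V := fun y => β.fiber (dep y) s₀ y with hAdef
  have hs := S.m_pos s₀
  have hx₀ := T.m_pos x₀
  set c : ℝ := S.m s₀ / T.m x₀ with hc
  have hc0 : 0 < c := div_pos hs hx₀
  have hfD : (D : Set T.V).indicator f = f :=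
    Set.indicator_eq_self.mpr fun y hy => by
      by_contra h
      exact hy (hf y h)
  have hup : ∀ y ∈ D, ∑ t ∈ A y, S.m t ≤ c * T.m y := by
    intro y hy
    rw [hAdef, sum_m_fiber hS hβ]
    have h1 := T.floorRatio_le q (dep y) y
    rw [hdep y hy] at h1
    calc _ ≤ T.m y / T.m x₀ * S.m s₀ := by gcongr
      _ = c * T.m y := by rw [hc]; ring
  have hlow : ∀ y ∈ D, (1 - η) * c * T.m y ≤ ∑ t ∈ A y, S.m t := by
    intro y hy
    rw [hAdef, sum_m_fiber hS hβ]
    calc _ = (1 - η) * (T.m y / T.m x₀) * S.m s₀ := by rw [hc]; ring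
      _ ≤ _ := by gcongr; exact hratio y hy
  set r : ℝ≥0∞ := ENNReal.ofReal c ^ (1 / p.toReal) with hr
  have hr0 : r ≠ 0 := by
    rw [hr, ne_eq, ENNReal.rpow_eq_zero_iff]
    simp [hc0]
  have hrtop : r ≠ ∞ := ENNReal.rpow_ne_top_of_nonneg (by positivity) ENNReal.ofReal_ne_top
  have hf' : eLpNorm (pullback D A f) p S.measure ≤ r * eLpNorm f p T.measure := by
    have h1 := eLpNorm_pullback_le hA f hp0 hc0.le hup
    rwa [hfD] at h1
  have hfin : eLpNorm f p T.measure ≠ ∞ := by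
    rw [← hfD]
    refine ne_top_of_le_ne_top ?_ (T.eLpNorm_indicator_finset_le f D hp)
    refine ENNReal.sum_ne_top.mpr fun x _ => ENNReal.mul_ne_top enorm_ne_top ?_
    exact ENNReal.rpow_ne_top_of_nonneg (by positivity) (T.measure_singleton_ne_top x)
  have hmem : MemLp (pullback D A f) p S.measure :=
    ⟨.of_discrete, hf'.trans_lt (ENNReal.mul_ne_top hrtop hfin).lt_top⟩
  set Kf : S.V → ℂ := fun x' => ∑' t, S.kernel (S.functionOfLaplacian F) x' t
    * pullback D A f t * (S.m t : ℂ) with hKf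
  have hKf' := (hbound _ hmem).2
  have hpt : ∀ t, ‖pullback D A G t‖ ≤ ‖Kf t‖ + ‖pullback D A (fun _ => (η : ℂ)) t‖ := by
    intro t
    by_cases h : ∃ y ∈ D, t ∈ A y
    · obtain ⟨y, hy, ht⟩ := h
      rw [pullback_of_mem hA G hy ht, pullback_of_mem hA _ hy ht, Complex.norm_real,
        Real.norm_of_nonneg hη0.le]
      have h1 := hG y hy t ht
      have h2 := norm_sub_norm_le (G y) (Kf t)
      rw [norm_sub_rev] at h2
      linarith
    · push Not at h
      rw [pullback_of_notMem G h, norm_zero]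
      positivity
  have hmain : ENNReal.ofReal ((1 - η) * c) ^ (1 / p.toReal)
        * eLpNorm ((D : Set T.V).indicator G) p T.measure
      ≤ C * (r * eLpNorm f p T.measure)
        + r * eLpNorm ((D : Set T.V).indicator fun _ => (η : ℂ)) p T.measure := by
    refine (le_eLpNorm_pullback hA G hp0 (mul_pos (by linarith) hc0) hlow).trans ?_
    refine (eLpNorm_mono_real hpt).trans ?_
    refine (eLpNorm_add_le .of_discrete .of_discrete hp).trans ?_
    rw [eLpNorm_norm, eLpNorm_norm]
    exact add_le_add (hKf'.trans (mul_le_mul_right hf' C))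
      (eLpNorm_pullback_le hA _ hp0 hc0.le hup)
  rw [ENNReal.ofReal_mul (by linarith), ENNReal.mul_rpow_of_nonneg _ _ (by positivity), ← hr,
    mul_comm _ r, mul_assoc, mul_left_comm C r, ← mul_add] at hmain
  exact (ENNReal.mul_le_mul_iff_right hr0 hrtop).mp hmain

end Transfer

/-! ### Passage to the limit in the `L^p` bounds. -/

theorem eLpNorm_le_of_frequently_lpBound (T : FlowTree) (𝕋 : ℕ+ → FlowTree)
    (h𝕋 : ∀ q : ℕ+, (𝕋 q).IsCanonicalHomogeneous q) {F : ℝ → ℂ} (hF : Continuous F)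
    {p C : ℝ≥0∞} (hp : 1 ≤ p)
    (hfreq : ∃ᶠ q in atTop, (𝕋 q).LpBound ((𝕋 q).kernel ((𝕋 q).functionOfLaplacian F)) p C)
    (D : Finset T.V) {f : T.V → ℂ} (hf : ∀ y ∉ D, f y = 0) {η : ℝ} (hη0 : 0 < η) (hη1 : η < 1) :
    ENNReal.ofReal (1 - η) ^ (1 / p.toReal) * eLpNorm ((D : Set T.V).indicator fun x =>
          ∑ y ∈ D, T.kernel (T.functionOfLaplacian F) x y * f y * (T.m y : ℂ)) p T.measure
      ≤ C * eLpNorm f p T.measure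
        + eLpNorm ((D : Set T.V).indicator fun _ => (η : ℂ)) p T.measure := by
  obtain ⟨M, hM⟩ := exists_norm_le_of_continuous hF
  obtain ⟨z, dep, hdep⟩ := T.exists_common_ancestor_finset D
  set G : T.V → ℂ := fun x =>
    ∑ y ∈ D, T.kernel (T.functionOfLaplacian F) x y * f y * (T.m y : ℂ) with hG
  -- Three errors of size η/3: truncation on T, rounding of label proportions, and the tail on 𝕋_q.
  -- The height J of the truncation is fixed on T alone, before q is taken large; it moves the
  -- common ancestor up to 𝔭^J z.
  obtain ⟨J, hJ⟩ : ∃ J : ℕ, ∀ x ∈ D, ‖∑ y ∈ D, f y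
      * (T.truncKernel F x y (J + dep x + 1) (J + dep y + 1) * T.m y) - G x‖ < η / 3 := by
    have h1 : ∀ᶠ J : ℕ in atTop, ∀ x ∈ D, ‖∑ y ∈ D, f y
        * (T.truncKernel F x y (J + dep x + 1) (J + dep y + 1) * T.m y) - G x‖ < η / 3 := by
      refine (Finset.eventually_all D).mpr fun x hx => ?_
      have h2 : Tendsto (fun J : ℕ => ∑ y ∈ D, f y
          * (T.truncKernel F x y (J + dep x + 1) (J + dep y + 1) * T.m y)) atTop (𝓝 (G x)) := by
        refine tendsto_finsetSum D fun y hy => ?_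
        have h3 := ((tendsto_truncKernel hF ((hdep x hx).trans
          (hdep y hy).symm)).mul_const (T.m y : ℂ)).const_mul (f y)
        rwa [show f y * (T.kernel (T.functionOfLaplacian F) x y * T.m y)
          = T.kernel (T.functionOfLaplacian F) x y * f y * T.m y by ring] at h3
      have h3 := (tendsto_iff_norm_sub_tendsto_zero.mp h2).eventually_lt_const
        (show (0 : ℝ) < η / 3 by linarith)
      exact h3
    exact h1.exists
  set dep' : T.V → ℕ := fun y => J + dep y with hdep'
  have hdepJ : ∀ y ∈ D, T.pred^[dep' y] y = T.pred^[J] z := fun y hy => by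
    rw [hdep', Function.iterate_add_apply, hdep y hy]
  have hmodel : ∀ᶠ q : ℕ+ in atTop, ∀ x ∈ D,
      ‖∑ y ∈ D, f y * T.modelWeight F q x y (dep' x + 1) (dep' y + 1)
        - ∑ y ∈ D, f y * (T.truncKernel F x y (dep' x + 1) (dep' y + 1) * T.m y)‖ < η / 3 := by
    refine (Finset.eventually_all D).mpr fun x _ => ?_
    have h2 := tendsto_finsetSum D fun y _ =>
      (tendsto_modelWeight F x y (dep' x + 1) (dep' y + 1)).const_mul (f y)
    exact (tendsto_iff_norm_sub_tendsto_zero.mp h2).eventually_lt_const (by linarith)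
  have herr : ∀ᶠ q : ℕ+ in atTop, 2 * M / q * ∑ y ∈ D, ‖f y‖ < η / 3 := by
    have h2 := (tendsto_one_div_pnat (2 * M)).mul_const (∑ y ∈ D, ‖f y‖)
    rw [zero_mul] at h2
    exact h2.eventually_lt_const (by linarith)
  have hratio : ∀ᶠ q : ℕ+ in atTop, ∀ y ∈ D,
      (1 - η) * (T.m y / T.m (T.pred^[J] z)) < T.floorRatio q (dep' y) y := by
    refine (Finset.eventually_all D).mpr fun y hy => ?_
    have h2 := T.tendsto_floorRatio (dep' y) y
    rw [hdepJ y hy] at h2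
    refine h2.eventually_const_lt ?_
    have := div_pos (T.m_pos y) (T.m_pos (T.pred^[J] z))
    nlinarith
  obtain ⟨q, hbound, ⟨hq1, hq2⟩, hq3⟩ :=
    (hfreq.and_eventually ((hmodel.and herr).and hratio)).exists
  obtain ⟨β, hβ⟩ := (h𝕋 q).exists_branching T
  obtain ⟨s₀⟩ := (𝕋 q).isTree.connected.nonempty
  refine eLpNorm_le_of_lpBound (h𝕋 q) hβ hp hbound hdepJ hf s₀ hη0 hη1
    (fun y hy => (hq3 y hy).le) fun x hx x' hx' => ?_
  have h1 := norm_tsum_kernel_pullback_sub_le (h𝕋 q) hβ hF hM hdepJ f hx hx'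
  have h2 := hq1 x hx
  have h3 := hJ x hx
  refine (norm_sub_le_norm_sub_add_norm_sub _
    (∑ y ∈ D, f y * T.modelWeight F q x y (dep' x + 1) (dep' y + 1)) _).trans ?_
  have h4 := norm_sub_le_norm_sub_add_norm_sub
    (∑ y ∈ D, f y * T.modelWeight F q x y (dep' x + 1) (dep' y + 1))
    (∑ y ∈ D, f y * (T.truncKernel F x y (dep' x + 1) (dep' y + 1) * T.m y)) (G x)
  linarith

theorem lpBound_of_frequently_lpBound (T : FlowTree) (𝕋 : ℕ+ → FlowTree)
    (h𝕋 : ∀ q : ℕ+, (𝕋 q).IsCanonicalHomogeneous q) {F : ℝ → ℂ} (hF : Continuous F)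
    {p C : ℝ≥0∞} (hp : 1 ≤ p) (hC : C ≠ ∞)
    (hfreq : ∃ᶠ q in atTop, (𝕋 q).LpBound ((𝕋 q).kernel ((𝕋 q).functionOfLaplacian F)) p C) :
    T.LpBound (T.kernel (T.functionOfLaplacian F)) p C := by
  refine lpBound_of_finset hp hC fun D f hf => ?_
  set X := eLpNorm ((D : Set T.V).indicator fun x =>
    ∑ y ∈ D, T.kernel (T.functionOfLaplacian F) x y * f y * (T.m y : ℂ)) p T.measure with hX
  have hle : ∀ᶠ η : ℝ in 𝓝[>] 0, ENNReal.ofReal (1 - η) ^ (1 / p.toReal) * X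
      ≤ C * eLpNorm f p T.measure
        + ∑ x ∈ D, ENNReal.ofReal η * T.measure {x} ^ (1 / p.toReal) := by
    filter_upwards [Ioo_mem_nhdsGT (zero_lt_one' ℝ)] with η hη
    refine (eLpNorm_le_of_frequently_lpBound T 𝕋 h𝕋 hF hp hfreq D hf hη.1 hη.2).trans ?_
    refine add_le_add le_rfl ((T.eLpNorm_indicator_finset_le _ D hp).trans_eq ?_)
    refine Finset.sum_congr rfl fun x _ => ?_
    rw [← ofReal_norm, Complex.norm_real, Real.norm_of_nonneg hη.1.le]
  have hid : Tendsto (fun η : ℝ => η) (𝓝[>] 0) (𝓝 0) := tendsto_nhdsWithin_of_tendsto_nhds tendsto_id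
  have hlim1 : Tendsto (fun η : ℝ => ENNReal.ofReal (1 - η) ^ (1 / p.toReal) * X) (𝓝[>] 0)
      (𝓝 X) := by
    have h1 : Tendsto (fun η : ℝ => ENNReal.ofReal (1 - η) ^ (1 / p.toReal)) (𝓝[>] 0) (𝓝 1) := by
      have h2 := (ENNReal.continuous_rpow_const (y := 1 / p.toReal)).tendsto 1
      rw [ENNReal.one_rpow] at h2
      refine h2.comp ?_
      have h3 := ENNReal.tendsto_ofReal (hid.const_sub 1)
      simpa using h3
    simpa using ENNReal.Tendsto.mul_const h1 (b := X) (Or.inl one_ne_zero)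
  have hlim2 : Tendsto (fun η : ℝ => C * eLpNorm f p T.measure
        + ∑ x ∈ D, ENNReal.ofReal η * T.measure {x} ^ (1 / p.toReal)) (𝓝[>] 0)
      (𝓝 (C * eLpNorm f p T.measure)) := by
    have h1 : Tendsto (fun η : ℝ => ∑ x ∈ D, ENNReal.ofReal η * T.measure {x} ^ (1 / p.toReal))
        (𝓝[>] 0) (𝓝 (∑ x ∈ D, 0)) := by
      refine tendsto_finsetSum D fun x _ => ?_
      have h2 := ENNReal.tendsto_ofReal hid
      rw [ENNReal.ofReal_zero] at h2
      simpa using ENNReal.Tendsto.mul_const h2 (Or.inr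
        (ENNReal.rpow_ne_top_of_nonneg (by positivity : 0 ≤ 1 / p.toReal)
          (T.measure_singleton_ne_top x)))
    simpa using h1.const_add (C * eLpNorm f p T.measure)
  exact le_of_tendsto_of_tendsto hlim1 hlim2 hle

theorem LpBound.mono {K : T.V → T.V → ℂ} {p C C' : ℝ≥0∞} (h : T.LpBound K p C) (hC : C ≤ C') :
    T.LpBound K p C' := fun f hf =>
  ⟨(h f hf).1, (h f hf).2.trans (mul_le_mul_left hC _)⟩

/-- Any C above the lower limit is a bound for arbitrarily large q, hence for T. Infinite C is set
apart because summability on T is deduced from a finite bound. -/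
theorem lpOpNorm_le_liminf (T : FlowTree) (𝕋 : ℕ+ → FlowTree)
    (h𝕋 : ∀ q : ℕ+, (𝕋 q).IsCanonicalHomogeneous q) {F : ℝ → ℂ} (hF : Continuous F)
    {p : ℝ≥0∞} (hp : 1 ≤ p) :
    T.LpOpNorm (T.functionOfLaplacian F) p ≤
      liminf (fun q : ℕ+ => (𝕋 q).LpOpNorm ((𝕋 q).functionOfLaplacian F) p) atTop := by
  refine le_of_forall_gt_imp_ge_of_dense fun C hC => ?_
  by_cases hCtop : C = ∞
  · rw [hCtop]
    exact le_top
  refine sInf_le (lpBound_of_frequently_lpBound T 𝕋 h𝕋 hF hp hCtop ?_)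
  refine (frequently_lt_of_liminf_lt (by isBoundedDefault) hC).mono fun q hq => ?_
  obtain ⟨C', hC', hlt⟩ := sInf_lt_iff.mp hq
  exact LpBound.mono hC' hlt.le

end FlowTree

/-- The Sobolev regularity of `F` is not needed: the expansion of the kernel of `F (𝓛)` converges
conditionally for every continuous `F`, which is enough for both bounds. -/
theorem theorem5p9
    (T : FlowTree) (𝕋 : ℕ+ → FlowTree) (h𝕋 : ∀ q : ℕ+, (𝕋 q).IsCanonicalHomogeneous q)
    (ε : ℝ) (hε : 0 < ε) (F : ℝ → ℂ) (hFcont : Continuous F) (hF : MemL2Sobolev (3 / 2 + ε) F) :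
    (∀ p : ℝ≥0∞, 1 ≤ p →
      T.LpOpNorm (T.functionOfLaplacian F) p ≤
        liminf (fun q : ℕ+ => (𝕋 q).LpOpNorm ((𝕋 q).functionOfLaplacian F) p) atTop) ∧
    (∀ w : ℕ → ℤ → ℤ → ℝ≥0, (∀ k l : ℤ, Monotone fun n : ℕ => w n k l) →
      T.weightedKernelNorm w (T.functionOfLaplacian F) ≤
        liminf (fun q : ℕ+ => (𝕋 q).weightedKernelNorm w ((𝕋 q).functionOfLaplacian F)) atTop) := by
  exact ⟨fun p hp => T.lpOpNorm_le_liminf 𝕋 h𝕋 hFcont hp,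
    fun w hw => T.weightedKernelNorm_le_liminf 𝕋 h𝕋 hFcont hw⟩
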